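/- **Corollary (cactus graphs are tractable with an oracle).** Let $G=(V,E)$ be a finite connected simple graph with a root $r\in V$ and two weight functions $\gamma,\tau:E\to\mathbb{R}$ (cable and trench costs). The generalized cable-trench cost of a spanning tree $T$ of $G$ is $$\mathrm{cost}(T)=\sum_{e\in E(T)}\tau(e)+\sum_{w\in V}\ \sum_{e\in P_T(r,w)}\gamma(e),$$ where $P_T(r,w)$ is the path from $r$ to $w$ in $T$; a cable-trench tree of $G$ is a spanning tree of $G$ of minimum cost. The graph $G$ is a cactus graph if each of its edges lies in at most one cycle. Suppose that for each cactus graph $G$ an oracle supplies a decomposition of $G$ into cycles and trees, that is, subgraphs $G_1,\dots,G_c$ of $G$, each of which is a cycle or a tree, such that the edge sets $E(G_1),\dots,E(G_c)$ form a partition of $E$ and any two distinct $G_i,G_j$ have at most one vertex in common. Then a cable-trench tree of a cactus graph can be computed in polynomial time. Precisely: there are one program for a random access machine, whose elementary steps are addition, subtraction, comparison, and direct or indirect access to a memory cell, each operating on natural numbers or on real weights, and a polynomial $p$, such that for every cactus graph $G$ with $n$ vertices, every root $r$, all weights $\gamma,\tau:E\to\mathbb{R}$, and every such decomposition of $G$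 that the oracle may supply, the program, given $G$, $r$, $\gamma$, $\tau$ and the decomposition as input, halts after at most $p(n)$ steps and outputs a cable-trench tree of $G$ with root $r$. -/

import Mathlib

namespace CableTrench

/-! ### The generalized cable-trench problem -/

section Problem

variable {V : Type*}

/-- The `γ`-length of the unique path from `u` to `v` in the tree `T`. -/
noncomputable def cableLength {T : SimpleGraph V} (hT : T.IsTree) (γ : Sym2 V → ℝ) (u v : V) : ℝ :=
  ((hT.existsUnique_path u v).choose.edges.map γ).sum

/-- Generalized cable-trench cost of a spanning tree `T` rooted at `r`: the total trench cost of the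
edges of `T`, plus the cable lengths of the paths in `T` from the root to all the vertices.
Only the values of `γ` and `τ` on edges of `T` matter. -/
noncomputable def cost [Fintype V] {T : SimpleGraph V} (hT : T.IsTree) (γ τ : Sym2 V → ℝ) (r : V) :
    ℝ :=
  (∑ᶠ e ∈ T.edgeSet, τ e) + ∑ w : V, cableLength hT γ r w

/-- `T` is a cable-trench tree (cable-trench solution) of `G` with root `r`: a spanning tree of `G`
whose cost is minimal among all spanning trees of `G`. -/
def IsCableTrenchTree [Fintype V] (G : SimpleGraph V) (γ τ : Sym2 V → ℝ) (r : V)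
    (T : SimpleGraph V) : Prop :=
  ∃ hT : T.IsTree, T ≤ G ∧ ∀ (S : SimpleGraph V) (hS : S.IsTree), S ≤ G →
    cost hT γ τ r ≤ cost hS γ τ r

/-- A cactus graph: a connected graph in which every edge lies in at most one cycle, that is, two
cycles with a common edge have the same edges. -/
def IsCactus (G : SimpleGraph V) : Prop :=
  G.Connected ∧
    ∀ (u v : V) (p : G.Walk u u) (q : G.Walk v v), p.IsCycle → q.IsCycle →
      (∃ e, e ∈ p.edges ∧ e ∈ q.edges) → ∀ f, f ∈ p.edges ↔ f ∈ q.edges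

/-- A decomposition of `G` into `c` cycles and trees, any two of which meet in at most one vertex.
The edge sets of the parts form a partition of the edge set of `G`. No further maximality of the
parts is required, so this comprises every more restrictive kind of such decompositions. -/
structure Decomposition (G : SimpleGraph V) (c : ℕ) where
  part : Fin c → G.Subgraph
  edges_nonempty : ∀ i, (part i).edgeSet.Nonempty
  edges_partition : ∀ e ∈ G.edgeSet, ∃! i, e ∈ (part i).edgeSet
  cycle_or_tree : ∀ i,
    (∃ (u : V) (p : G.Walk u u), p.IsCycle ∧ part i = p.toSubgraph) ∨ (part i).coe.IsTree
  inter_subsingleton : ∀ i j, i ≠ j → ((part i).verts ∩ (part j).verts).Subsingleton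

/-- The index of the part that contains a given edge. -/
noncomputable def Decomposition.label {G : SimpleGraph V} {c : ℕ} (D : Decomposition G c)
    (e : Sym2 V) (he : e ∈ G.edgeSet) : Fin c :=
  (D.edges_partition e he).choose

/-- A listing, without repetition, of the edges of `G` by their two end points. -/
structure EdgeListing (G : SimpleGraph V) (m : ℕ) where
  src : Fin m → V
  tgt : Fin m → V
  injective : Function.Injective fun k => s(src k, tgt k)
  range_eq : Set.range (fun k => s(src k, tgt k)) = G.edgeSet

/-- The `k`-th edge of the listing. -/
def EdgeListing.edge {G : SimpleGraph V} {m : ℕ} (L : EdgeListing G m) (k : Fin m) : Sym2 V :=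
  s(L.src k, L.tgt k)

theorem EdgeListing.edge_mem {G : SimpleGraph V} {m : ℕ} (L : EdgeListing G m) (k : Fin m) :
    L.edge k ∈ G.edgeSet :=
  L.range_eq ▸ ⟨k, rfl⟩

end Problem

/-! ### The machine model

A random access machine with registers and arrays (indirect addressing) for natural numbers, which
serve as indices, and for real numbers, which serve as weights. Each elementary instruction and each
test takes one step. The only arithmetic operations are addition and subtraction and the only
predicate is comparison, so that on rational weights the bit length of every stored number grows by
at most a constant per step. A program mentions only finitely many registers and arrays. -/

/-- Contents of the word registers, word arrays, real registers and real arrays. -/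
structure State where
  reg : ℕ → ℕ
  arr : ℕ → ℕ → ℕ
  rreg : ℕ → ℝ
  rarr : ℕ → ℕ → ℝ

/-- Elementary instructions. -/
inductive Instr where
  | skip
  | const (i c : ℕ)
  | add (i j k : ℕ)
  | sub (i j k : ℕ)
  | load (i a j : ℕ)
  | store (a i j : ℕ)
  | rzero (i : ℕ)
  | radd (i j k : ℕ)
  | rsub (i j k : ℕ)
  | rload (i a j : ℕ)
  | rstore (a i j : ℕ)

/-- The effect of an elementary instruction. -/
noncomputable def Instr.apply : Instr → State → State
  | .skip, s => s
  | .const i c, s => { s with reg := Function.update s.reg i c }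
  | .add i j k, s => { s with reg := Function.update s.reg i (s.reg j + s.reg k) }
  -- truncated subtraction of natural numbers
  | .sub i j k, s => { s with reg := Function.update s.reg i (s.reg j - s.reg k) }
  | .load i a j, s => { s with reg := Function.update s.reg i (s.arr a (s.reg j)) }
  | .store a i j, s =>
      { s with arr := Function.update s.arr a (Function.update (s.arr a) (s.reg i) (s.reg j)) }
  | .rzero i, s => { s with rreg := Function.update s.rreg i 0 }
  | .radd i j k, s => { s with rreg := Function.update s.rreg i (s.rreg j + s.rreg k) }
  | .rsub i j k, s => { s with rreg := Function.update s.rreg i (s.rreg j - s.rreg k) }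
  | .rload i a j, s => { s with rreg := Function.update s.rreg i (s.rarr a (s.reg j)) }
  | .rstore a i j, s =>
      { s with rarr := Function.update s.rarr a (Function.update (s.rarr a) (s.reg i) (s.rreg j)) }

/-- Tests: comparison of two word registers or of two real registers. -/
inductive Test where
  | lt (i j : ℕ)
  | rlt (i j : ℕ)

/-- The truth value of a test. -/
def Test.Holds : Test → State → Prop
  | .lt i j, s => s.reg i < s.reg j
  | .rlt i j, s => s.rreg i < s.rreg j

/-- Programs. -/
inductive Prog where
  | instr (a : Instr)
  | seq (P Q : Prog)
  | ite (b : Test) (P Q : Prog)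
  | loop (b : Test) (P : Prog)

/-- `Exec P s t s'`: started in state `s`, the program `P` halts after exactly `t` steps, in
state `s'`. The program `loop b P` executes `P` as long as `b` holds. -/
inductive Exec : Prog → State → ℕ → State → Prop
  | instr (a : Instr) (s : State) : Exec (.instr a) s 1 (a.apply s)
  | seq {P Q : Prog} {s s₁ s₂ : State} {t₁ t₂ : ℕ} :
      Exec P s t₁ s₁ → Exec Q s₁ t₂ s₂ → Exec (.seq P Q) s (t₁ + t₂) s₂
  | ite_true {b : Test} {P Q : Prog} {s s' : State} {t : ℕ} :
      b.Holds s → Exec P s t s' → Exec (.ite b P Q) s (t + 1) s'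
  | ite_false {b : Test} {P Q : Prog} {s s' : State} {t : ℕ} :
      ¬ b.Holds s → Exec Q s t s' → Exec (.ite b P Q) s (t + 1) s'
  | loop_true {b : Test} {P : Prog} {s s₁ s₂ : State} {t₁ t₂ : ℕ} :
      b.Holds s → Exec P s t₁ s₁ → Exec (.loop b P) s₁ t₂ s₂ →
        Exec (.loop b P) s (t₁ + t₂ + 1) s₂
  | loop_false {b : Test} {P : Prog} {s : State} :
      ¬ b.Holds s → Exec (.loop b P) s 1 s

/-- The machine is deterministic: the final state and the running time are determined. -/
theorem Exec.deterministic {P : Prog} {s s₁ s₂ : State} {t₁ t₂ : ℕ}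
    (h₁ : Exec P s t₁ s₁) (h₂ : Exec P s t₂ s₂) : t₁ = t₂ ∧ s₁ = s₂ := by
  induction h₁ generalizing t₂ s₂ with
  | instr a s => cases h₂; exact ⟨rfl, rfl⟩
  | seq _ _ ih₁ ih₂ =>
    cases h₂ with
    | seq k₁ k₂ =>
      obtain ⟨rfl, rfl⟩ := ih₁ k₁
      obtain ⟨rfl, rfl⟩ := ih₂ k₂
      exact ⟨rfl, rfl⟩
  | ite_true hb _ ih =>
    cases h₂ with
    | ite_true _ k => obtain ⟨rfl, rfl⟩ := ih k; exact ⟨rfl, rfl⟩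
    | ite_false hb' _ => exact absurd hb hb'
  | ite_false hb _ ih =>
    cases h₂ with
    | ite_true hb' _ => exact absurd hb' hb
    | ite_false _ k => obtain ⟨rfl, rfl⟩ := ih k; exact ⟨rfl, rfl⟩
  | loop_true hb _ _ ih₁ ih₂ =>
    cases h₂ with
    | loop_true _ k₁ k₂ =>
      obtain ⟨rfl, rfl⟩ := ih₁ k₁
      obtain ⟨rfl, rfl⟩ := ih₂ k₂
      exact ⟨rfl, rfl⟩
    | loop_false hb' => exact absurd hb hb'
  | loop_false hb =>
    cases h₂ with
    | loop_true hb' _ _ => exact absurd hb' hb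
    | loop_false _ => exact ⟨rfl, rfl⟩

/-! ### Input and output -/

/-- The initial state for the graph `G` on the vertices `0, …, n - 1`, with root `r`, weights `γ`
and `τ`, and the decomposition `D` supplied by the oracle. The registers `0` to `3` hold the number
of vertices, of edges and of parts, and the root; the word arrays `0` and `1` hold the end points of
the edges, the word array `2` the part to which each edge belongs; the real arrays `0` and `1` hold
the cable and trench costs of the edges. Everything else is `0`. -/
noncomputable def inputState {n m c : ℕ} {G : SimpleGraph (Fin n)} (L : EdgeListing G m)
    (D : Decomposition G c) (γ τ : Sym2 (Fin n) → ℝ) (r : Fin n) : State where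
  reg
    | 0 => n
    | 1 => m
    | 2 => c
    | 3 => r
    | _ => 0
  arr a k :=
    if h : k < m then
      match a with
      | 0 => L.src ⟨k, h⟩
      | 1 => L.tgt ⟨k, h⟩
      | 2 => D.label (L.edge ⟨k, h⟩) (L.edge_mem ⟨k, h⟩)
      | _ => 0
    else 0
  rreg _ := 0
  rarr a k :=
    if h : k < m then
      match a with
      | 0 => γ (L.edge ⟨k, h⟩)
      | 1 => τ (L.edge ⟨k, h⟩)
      | _ => 0
    else 0

/-- The graph that a final state describes: its edges are those listed edges whose entry in the word
array `3` is `1`. -/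
def outputGraph {n m : ℕ} {G : SimpleGraph (Fin n)} (L : EdgeListing G m) (s : State) :
    SimpleGraph (Fin n) :=
  SimpleGraph.fromEdgeSet {e | ∃ k : Fin m, s.arr 3 k = 1 ∧ e = L.edge k}

end CableTrench

/-! Let `G` be a cactus and `T` a spanning tree of `G`. By the cactus property the fundamental
cycles of the omitted edges have pairwise disjoint edge sets, so the number of vertices below an
edge `f` of `T` is the number that the removal of `f` cuts off from the root in `G`, plus the
excess that is caused by the one omitted edge on the cycle through `f`. Summed over `f`, the cost
of `T` is a constant plus the sum of the penalties of the omitted edges, and each penalty is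
determined by `G` alone, through the sizes of the components of `G` without one or two edges.
Hence the optimum omits from each cycle an edge of minimal penalty, ties being broken by the
position in the input. All this is found by graph searches. -/

namespace CableTrench

section Trees

open SimpleGraph

variable {V : Type*}

/-- The unordered pairs of vertices in different components of `H`. For a spanning tree `T`, an
edge outside `T` lies in `separated (T.deleteEdges {f})` iff its fundamental cycle passes
through `f`. -/
def separated (H : SimpleGraph V) : Set (Sym2 V) :=
  Sym2.fromRel (r := fun a b => ¬ H.Reachable a b) ⟨fun _ _ h h' => h h'.symm⟩

theorem mk_mem_separated {H : SimpleGraph V} {a b : V} :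
    s(a, b) ∈ separated H ↔ ¬ H.Reachable a b :=
  Iff.rfl

theorem separated_eq_empty {H : SimpleGraph V} (hH : H.Connected) : separated H = ∅ :=
  Set.eq_empty_iff_forall_notMem.2 <| Sym2.ind fun a b h => h (hH.preconnected a b)

theorem not_isDiag_of_mem_separated {H : SimpleGraph V} {e : Sym2 V} (he : e ∈ separated H) :
    ¬ e.IsDiag := by
  induction e with | _ a b => exact fun h => he (Sym2.mk_isDiag_iff.1 h ▸ Reachable.refl a)

theorem notMem_edgeSet_of_mem_separated_deleteEdges {T : SimpleGraph V} {e f : Sym2 V}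
    (he : e ∈ separated (T.deleteEdges {f})) (hef : e ≠ f) : e ∉ T.edgeSet := by
  induction e with
  | _ a b => exact fun h => he (Adj.reachable (deleteEdges_adj.2 ⟨h, hef⟩))

theorem notMem_separated_deleteEdges_self {T : SimpleGraph V} (hT : T.Connected) {f : Sym2 V}
    (hf : f ∉ T.edgeSet) : f ∉ separated (T.deleteEdges {f}) := by
  rw [deleteEdges_eq_self.2 (Set.disjoint_singleton_right.2 hf), separated_eq_empty hT]
  exact Set.notMem_empty f

theorem reachable_of_forall_adj {H K : SimpleGraph V} (h : ∀ a b, H.Adj a b → K.Reachable a b)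
    {a b : V} (hab : H.Reachable a b) : K.Reachable a b := by
  obtain ⟨p⟩ := hab
  induction p with
  | nil => exact Reachable.refl _
  | cons hadj _ ih => exact (h _ _ hadj).trans ih

theorem reachable_iff_of_disjoint_separated {H K : SimpleGraph V} (hle : H ≤ K)
    (hK : Disjoint K.edgeSet (separated H)) {a b : V} : K.Reachable a b ↔ H.Reachable a b :=
  ⟨reachable_of_forall_adj fun _ _ hadj => not_not.1 <|
    mt mk_mem_separated.2 (Set.disjoint_left.1 hK hadj), Reachable.mono hle⟩

theorem exists_isCycle_of_mem_separated {G T : SimpleGraph V} (hT : T.Connected) (hle : T ≤ G)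
    {e f : Sym2 V} (he : e ∈ G.edgeSet) (heT : e ∉ T.edgeSet)
    (hef : e ∈ separated (T.deleteEdges {f})) :
    ∃ (u : V) (p : G.Walk u u), p.IsCycle ∧ f ∈ p.edges ∧ e ∈ p.edges ∧
      ∀ x ∈ p.edges, x ∉ T.edgeSet → x = e := by
  induction e with | _ a b => ?_
  obtain ⟨p, hp⟩ := hT.exists_isPath b a
  have hfp : f ∈ p.edges := p.mem_edges_of_not_reachable_deleteEdges fun h => hef h.symm
  have hpT : ∀ x ∈ p.edges, x ∈ T.edgeSet := fun _ hx => p.edges_subset_edgeSet hx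
  have hadj : G.Adj a b := he
  refine ⟨a, Walk.cons hadj (p.mapLe hle), (Walk.cons_isCycle_iff _ _).2 ⟨hp.mapLe hle, ?_⟩, ?_⟩ <;>
    simp only [Walk.edges_cons, Walk.edges_mapLe_eq_edges, List.mem_cons]
  · exact fun h => heT (hpT _ h)
  · exact ⟨Or.inr hfp, Or.inl trivial, fun x hx hxT => hx.resolve_right fun h => hxT (hpT x h)⟩

theorem connected_of_mem_separated {T K : SimpleGraph V} (hT : T.Connected) {e f : Sym2 V}
    (hle : T.deleteEdges {f} ≤ K) (he : e ∈ K.edgeSet)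
    (hef : e ∈ separated (T.deleteEdges {f})) : K.Connected := by
  have hle' : T ≤ T ⊔ K := le_sup_left
  by_cases heq : e = f
  · refine hT.mono (edgeSet_subset_edgeSet.1 fun x hx => ?_)
    by_cases hxf : x = f
    · exact hxf ▸ heq ▸ he
    · exact edgeSet_subset_edgeSet.2 hle (by simp [hx, hxf])
  obtain ⟨u, p, hp, hfp, -⟩ := exists_isCycle_of_mem_separated hT hle'
    (edgeSet_subset_edgeSet.2 le_sup_right he)
    (notMem_edgeSet_of_mem_separated_deleteEdges hef heq) hef
  have hf : ¬ (T ⊔ K).IsBridge f := fun h => h.notMem_edges_of_isCycle hp hfp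
  have hsup : (T ⊔ K).deleteEdges {f} ≤ K :=
    edgeSet_subset_edgeSet.1 fun x hx => by
      simp only [edgeSet_deleteEdges, edgeSet_sup, Set.mem_sdiff, Set.mem_union] at hx
      exact hx.1.elim (fun h => edgeSet_subset_edgeSet.2 hle (by simpa using ⟨h, hx.2⟩)) id
  induction f with
  | _ a b => exact ((hT.mono hle').connected_delete_edge_of_not_isBridge hf).mono hsup

theorem not_connected_deleteEdges_of_mem {T : SimpleGraph V} (hT : T.IsTree) {f : Sym2 V}
    (hf : f ∈ T.edgeSet) : ¬ (T.deleteEdges {f}).Connected := by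
  induction f with
  | _ a b => exact fun h => isAcyclic_iff_forall_isBridge.1 hT.isAcyclic hf (h.preconnected a b)

theorem mem_edges_iff_not_reachable {T : SimpleGraph V} (hT : T.IsTree) {u v : V}
    {p : T.Walk u v} (hp : p.IsPath) (e : Sym2 V) :
    e ∈ p.edges ↔ ¬ (T.deleteEdges {e}).Reachable u v := by
  refine ⟨fun he hr => ?_, p.mem_edges_of_not_reachable_deleteEdges⟩
  obtain ⟨q, hq⟩ := hr.exists_isPath
  have hpq := (hT.existsUnique_path u v).unique hp (hq.mapLe (deleteEdges_le _))
  rw [hpq, Walk.edges_mapLe_eq_edges] at he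
  have he' := q.edges_subset_edgeSet he
  rw [edgeSet_deleteEdges] at he'
  exact he'.2 rfl

/-- The graph obtained from `T` by exchanging the edge `f` for `e`. -/
def exchange (T : SimpleGraph V) (f e : Sym2 V) : SimpleGraph V :=
  T.deleteEdges {f} ⊔ fromEdgeSet {e}

theorem edgeSet_exchange {T : SimpleGraph V} {e f : Sym2 V} (he : ¬ e.IsDiag) :
    (exchange T f e).edgeSet = insert e (T.edgeSet \ {f}) := by
  have hdiag : Disjoint {e} Sym2.diagSet := Set.disjoint_singleton_left.2 he
  rw [exchange, edgeSet_sup, edgeSet_deleteEdges, edgeSet_fromEdgeSet, hdiag.sdiff_eq_left,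
    Set.union_singleton]

theorem isTree_exchange {T : SimpleGraph V} (hT : T.IsTree) {e f : Sym2 V}
    (hef : e ∈ separated (T.deleteEdges {f})) : (exchange T f e).IsTree := by
  have he : e ∈ (exchange T f e).edgeSet := by
    simp [edgeSet_exchange (not_isDiag_of_mem_separated hef)]
  refine ⟨connected_of_mem_separated hT.connected le_sup_left he hef, ?_⟩
  induction e with
  | _ a b => exact (hT.isAcyclic.anti (deleteEdges_le _)).sup_edge_of_not_reachable hef

theorem IsCactus.eq_of_mem_separated {G T : SimpleGraph V} (hG : IsCactus G) (hT : T.Connected)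
    (hle : T ≤ G) {e e' f : Sym2 V} (he : e ∈ G.edgeSet \ T.edgeSet)
    (he' : e' ∈ G.edgeSet \ T.edgeSet) (hef : e ∈ separated (T.deleteEdges {f}))
    (hef' : e' ∈ separated (T.deleteEdges {f})) : e = e' := by
  obtain ⟨u, p, hp, hfp, hep, -⟩ := exists_isCycle_of_mem_separated hT hle he.1 he.2 hef
  obtain ⟨v, q, hq, hfq, -, hqT⟩ := exists_isCycle_of_mem_separated hT hle he'.1 he'.2 hef'
  exact hqT e ((hG.2 u v p q hp hq ⟨f, hfp, hfq⟩ e).1 hep) he.2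

end Trees

section Cuts

open SimpleGraph

variable {V : Type*}

/-- The number of vertices of `H` that are not reachable from `r`. -/
noncomputable def unreached (H : SimpleGraph V) (r : V) : ℕ :=
  {w | ¬ H.Reachable r w}.ncard

theorem unreached_eq_zero_iff [Finite V] {H : SimpleGraph V} {r : V} :
    unreached H r = 0 ↔ H.Connected := by
  rw [unreached, Set.ncard_eq_zero, connected_iff_exists_forall_reachable]
  simp only [Set.eq_empty_iff_forall_notMem, Set.mem_ofPred_eq, not_not]
  exact ⟨fun h => ⟨r, h⟩, fun ⟨v, hv⟩ w => (hv r).symm.trans (hv w)⟩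

theorem unreached_congr {H K : SimpleGraph V} {r : V}
    (h : ∀ w, H.Reachable r w ↔ K.Reachable r w) : unreached H r = unreached K r := by
  simp only [unreached, h]

open Classical in
theorem unreached_eq_ite [Finite V] {T K : SimpleGraph V} (hT : T.Connected) {f : Sym2 V}
    (hle : T.deleteEdges {f} ≤ K) (r : V) :
    unreached K r = if Disjoint K.edgeSet (separated (T.deleteEdges {f}))
      then unreached (T.deleteEdges {f}) r else 0 := by
  split_ifs with hK
  · exact unreached_congr fun w => reachable_iff_of_disjoint_separated hle hK
  · obtain ⟨e, he, hef⟩ := Set.not_disjoint_iff.1 hK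
    exact unreached_eq_zero_iff.2 (connected_of_mem_separated hT hle he hef)

/-- The number of vertices that the removal of `e` and `f` cuts off from the root `r`. -/
noncomputable def cut (G : SimpleGraph V) (r : V) (e f : Sym2 V) : ℕ :=
  unreached (G.deleteEdges {e, f}) r

/-- The number of vertices that the removal of `e` cuts off from the root `r` once `f` has been
removed. No truncation occurs in the difference. -/
noncomputable def excess (G : SimpleGraph V) (r : V) (e f : Sym2 V) : ℕ :=
  cut G r e f - cut G r f f

theorem cut_comm (G : SimpleGraph V) (r : V) (e f : Sym2 V) : cut G r e f = cut G r f e := by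
  rw [cut, cut, Set.pair_comm]

variable {G T : SimpleGraph V} {r : V}

theorem cut_self_of_le [Finite V] (hT : T.Connected) (hle : T ≤ G) {e : Sym2 V}
    (he : e ∉ T.edgeSet) : cut G r e e = 0 :=
  unreached_eq_zero_iff.2 <| hT.mono <| edgeSet_subset_edgeSet.1 fun x hx => by
    simpa using ⟨edgeSet_subset_edgeSet.2 hle hx, fun h => he (h ▸ hx)⟩

theorem unreached_deleteEdges_of_notMem [Finite V] (hT : T.Connected) {f : Sym2 V}
    (hf : f ∉ T.edgeSet) : unreached (T.deleteEdges {f}) r = 0 := by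
  rwa [deleteEdges_eq_self.2 (Set.disjoint_singleton_right.2 hf), unreached_eq_zero_iff]

variable [Fintype V]

/-- The chords of `T` in `G`. -/
noncomputable def chords (G T : SimpleGraph V) : Finset (Sym2 V) :=
  open Classical in G.edgeFinset \ T.edgeFinset

theorem mem_chords {e : Sym2 V} : e ∈ chords G T ↔ e ∈ G.edgeSet ∧ e ∉ T.edgeSet := by
  simp [chords]

open Classical in
theorem cut_eq_ite (hT : T.Connected) (hle : T ≤ G) {e f : Sym2 V} (he : e ∈ T.edgeSet → e = f) :
    cut G r e f = if ∃ x ∈ chords G T, x ≠ e ∧ x ∈ separated (T.deleteEdges {f})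
      then 0 else unreached (T.deleteEdges {f}) r := by
  have hle' : T.deleteEdges {f} ≤ G.deleteEdges {e, f} := edgeSet_subset_edgeSet.1 fun x hx => by
    rw [edgeSet_deleteEdges] at hx ⊢
    refine ⟨edgeSet_subset_edgeSet.2 hle hx.1, ?_⟩
    rintro (rfl | hxf)
    exacts [hx.2 (he hx.1), hx.2 hxf]
  have hiff : Disjoint (G.deleteEdges {e, f}).edgeSet (separated (T.deleteEdges {f})) ↔
      ¬ ∃ x ∈ chords G T, x ≠ e ∧ x ∈ separated (T.deleteEdges {f}) := by
    rw [edgeSet_deleteEdges, ← not_iff_not, not_not, Set.not_disjoint_iff]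
    constructor
    · rintro ⟨x, ⟨hxG, hx⟩, hxf⟩
      rw [Set.mem_insert_iff, not_or] at hx
      exact ⟨x, mem_chords.2 ⟨hxG, notMem_edgeSet_of_mem_separated_deleteEdges hxf hx.2⟩, hx.1, hxf⟩
    · rintro ⟨x, hx, hxe, hxf⟩
      obtain ⟨hxG, hxT⟩ := mem_chords.1 hx
      refine ⟨x, ⟨hxG, ?_⟩, hxf⟩
      rintro (rfl | rfl)
      · exact hxe rfl
      · exact notMem_separated_deleteEdges_self hT hxT hxf
  rw [cut, unreached_eq_ite hT hle', ← ite_not]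
  simp only [hiff, not_not]

open Classical in
theorem IsCactus.excess_eq_ite (hG : IsCactus G) (hT : T.Connected) (hle : T ≤ G) {e f : Sym2 V}
    (he : e ∈ chords G T) :
    excess G r e f = if e ∈ separated (T.deleteEdges {f})
      then unreached (T.deleteEdges {f}) r else 0 := by
  have heT : e ∈ T.edgeSet → e = f := fun h => absurd h (mem_chords.1 he).2
  have huniq : ∀ x ∈ chords G T, x ∈ separated (T.deleteEdges {f}) →
      e ∈ separated (T.deleteEdges {f}) → x = e := fun x hx hxf hef =>
    hG.eq_of_mem_separated hT hle (mem_chords.1 hx) (mem_chords.1 he) hxf hef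
  have hff : ∀ x ∈ chords G T, x ∈ separated (T.deleteEdges {f}) → x ≠ f := by
    rintro x hx hxf rfl
    exact notMem_separated_deleteEdges_self hT (mem_chords.1 hx).2 hxf
  rw [excess, cut_eq_ite hT hle heT, cut_eq_ite hT hle fun _ => rfl]
  by_cases hef : e ∈ separated (T.deleteEdges {f})
  · rw [if_neg fun ⟨x, hx, hxe, hxf⟩ => hxe (huniq x hx hxf hef), if_pos ⟨e, he, hff e he hef, hef⟩,
      if_pos hef, Nat.sub_zero]
  · have hiff : (∃ x ∈ chords G T, x ≠ e ∧ x ∈ separated (T.deleteEdges {f})) ↔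
        ∃ x ∈ chords G T, x ≠ f ∧ x ∈ separated (T.deleteEdges {f}) :=
      exists_congr fun x => and_congr_right fun hx => and_congr_left fun hxf =>
        iff_of_true (fun h => hef (h ▸ hxf)) (hff x hx hxf)
    simp only [hiff, Nat.sub_self, if_neg hef]

theorem IsCactus.unreached_deleteEdges_eq_cut_add_sum (hG : IsCactus G) (hT : T.Connected)
    (hle : T ≤ G) (f : Sym2 V) :
    unreached (T.deleteEdges {f}) r = cut G r f f + ∑ e ∈ chords G T, excess G r e f := by
  classical
  rw [cut_eq_ite hT hle fun _ => rfl]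
  split_ifs with h
  · obtain ⟨e, he, -, hef⟩ := h
    rw [zero_add, Finset.sum_eq_single_of_mem e he, hG.excess_eq_ite hT hle he, if_pos hef]
    intro x hx hxe
    rw [hG.excess_eq_ite hT hle hx, if_neg]
    exact fun hxf => hxe
      (hG.eq_of_mem_separated hT hle (mem_chords.1 hx) (mem_chords.1 he) hxf hef)
  · rw [Finset.sum_eq_zero, add_zero]
    intro x hx
    rw [hG.excess_eq_ite hT hle hx, if_neg]
    rintro hxf
    refine h ⟨x, hx, ?_, hxf⟩
    rintro rfl
    exact notMem_separated_deleteEdges_self hT (mem_chords.1 hx).2 hxf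

end Cuts

section Cost

open SimpleGraph

variable {V : Type*} [Fintype V] {G T : SimpleGraph V}

open Classical in
theorem cableLength_eq_sum (hT : T.IsTree) (γ : Sym2 V → ℝ) (u v : V) :
    cableLength hT γ u v =
      ∑ e ∈ T.edgeFinset, if (T.deleteEdges {e}).Reachable u v then 0 else γ e := by
  have hp : (hT.existsUnique_path u v).choose.IsPath := (hT.existsUnique_path u v).choose_spec.1
  rw [cableLength]
  generalize (hT.existsUnique_path u v).choose = p at hp
  have hedges : p.edges.toFinset =
      T.edgeFinset.filter fun e => ¬ (T.deleteEdges {e}).Reachable u v := by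
    ext e
    rw [List.mem_toFinset, Finset.mem_filter, mem_edgeFinset,
      ← mem_edges_iff_not_reachable hT hp, iff_and_self]
    exact fun h => p.edges_subset_edgeSet h
  rw [← List.sum_toFinset _ hp.isTrail.edges_nodup, hedges, Finset.sum_filter]
  simp only [ite_not]

open Classical in
theorem cost_eq_sum (hT : T.IsTree) (γ τ : Sym2 V → ℝ) (r : V) :
    cost hT γ τ r = ∑ e ∈ T.edgeFinset, τ e +
      ∑ e ∈ T.edgeFinset, γ e * unreached (T.deleteEdges {e}) r := by
  rw [cost]
  congr 1
  · rw [← finsum_mem_coe_finset, coe_edgeFinset]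
  · simp_rw [cableLength_eq_sum]
    rw [Finset.sum_comm]
    refine Finset.sum_congr rfl fun e _ => ?_
    rw [unreached, Set.ncard_eq_toFinset_card', Set.toFinset_ofPred, Finset.card_filter]
    push_cast
    rw [Finset.mul_sum]
    simp only [ite_not, mul_ite, mul_zero, mul_one]

/-- The cost of omitting the edge `e` from a spanning tree of the cactus `G`. -/
noncomputable def penalty (G : SimpleGraph V) (γ τ : Sym2 V → ℝ) (r : V) (e : Sym2 V) : ℝ :=
  open Classical in ∑ f ∈ G.edgeFinset, γ f * excess G r e f - τ e

open Classical in
theorem IsCactus.cost_eq_sum_penalty (hG : IsCactus G) (hT : T.IsTree) (hle : T ≤ G)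
    (γ τ : Sym2 V → ℝ) (r : V) :
    cost hT γ τ r = ∑ e ∈ chords G T, penalty G γ τ r e +
      (∑ e ∈ G.edgeFinset, τ e + ∑ f ∈ G.edgeFinset, γ f * cut G r f f) := by
  have hsub : T.edgeFinset ⊆ G.edgeFinset := edgeFinset_subset_edgeFinset.2 hle
  have htrench : ∑ e ∈ G.edgeFinset, τ e = ∑ e ∈ chords G T, τ e + ∑ e ∈ T.edgeFinset, τ e :=
    (Finset.sum_sdiff hsub).symm
  have hcable : ∑ f ∈ T.edgeFinset, γ f * unreached (T.deleteEdges {f}) r =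
      ∑ f ∈ G.edgeFinset, γ f * unreached (T.deleteEdges {f}) r := by
    refine Finset.sum_subset hsub fun f _ hf => ?_
    rw [unreached_deleteEdges_of_notMem hT.connected (mt mem_edgeFinset.2 hf), Nat.cast_zero,
      mul_zero]
  have hpenalty : ∑ e ∈ chords G T, penalty G γ τ r e =
      ∑ f ∈ G.edgeFinset, γ f * ∑ e ∈ chords G T, (excess G r e f : ℝ) -
        ∑ e ∈ chords G T, τ e := by
    simp only [penalty, Finset.sum_sub_distrib, Finset.mul_sum]
    rw [Finset.sum_comm]
  rw [cost_eq_sum, hcable, htrench, hpenalty]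
  simp only [hG.unreached_deleteEdges_eq_cut_add_sum hT.connected hle, Nat.cast_add, Nat.cast_sum,
    mul_add, Finset.sum_add_distrib]
  ring

end Cost

section Optimum

open SimpleGraph

variable {V : Type*} [Fintype V] {G T : SimpleGraph V} {r : V}

theorem sum_chords_exchange {A : Type*} [AddCommMonoid A] (w : Sym2 V → A) (hle : T ≤ G)
    {e f : Sym2 V} (he : e ∈ chords G T) (hf : f ∈ T.edgeSet)
    (hef : e ∈ separated (T.deleteEdges {f})) :
    ∑ x ∈ chords G (exchange T f e), w x + w e = ∑ x ∈ chords G T, w x + w f := by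
  classical
  have hfG : f ∈ G.edgeSet := edgeSet_subset_edgeSet.2 hle hf
  have hne : f ≠ e := fun h => (mem_chords.1 he).2 (h ▸ hf)
  have hfT : f ∉ (chords G T).erase e := fun h =>
    (mem_chords.1 (Finset.mem_of_mem_erase h)).2 hf
  have hchords : chords G (exchange T f e) = insert f ((chords G T).erase e) := by
    ext x
    rw [mem_chords, edgeSet_exchange (not_isDiag_of_mem_separated hef), Finset.mem_insert,
      Finset.mem_erase, mem_chords, Set.mem_insert_iff, Set.mem_sdiff, Set.mem_singleton_iff]
    by_cases hxf : x = f
    · simp [hxf, hfG, hne]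
    · simp only [hxf, not_false_eq_true, and_true, false_or, not_or]
      tauto
  rw [hchords, Finset.sum_insert hfT, add_assoc, Finset.sum_erase_add _ _ he, add_comm]

variable {A : Type*} [AddCommMonoid A] [LinearOrder A]

/-- `T` is a spanning tree of `G` that minimizes the total weight of the omitted edges. -/
def IsMinOmissionTree (G : SimpleGraph V) (w : Sym2 V → A) (T : SimpleGraph V) : Prop :=
  MinimalFor (fun S : SimpleGraph V => S.IsTree ∧ S ≤ G) (fun S => ∑ e ∈ chords G S, w e) T

/-- The edges that are no bridges and whose weight is minimal on the cycle through them. -/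
def omitted (G : SimpleGraph V) (r : V) (w : Sym2 V → A) : Set (Sym2 V) :=
  {e ∈ G.edgeSet | cut G r e e = 0 ∧ ∀ f ∈ G.edgeSet, excess G r e f ≠ 0 → w e ≤ w f}

theorem exists_isMinOmissionTree (hG : G.Connected) (w : Sym2 V → A) :
    ∃ T, IsMinOmissionTree G w T := by
  obtain ⟨S, hle, hS⟩ := hG.exists_isTree_le
  exact (Set.toFinite {S : SimpleGraph V | S.IsTree ∧ S ≤ G}).exists_minimalFor _ _ ⟨S, hS, hle⟩

theorem IsMinOmissionTree.sum_le {w : Sym2 V → A} (hT : IsMinOmissionTree G w T)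
    {S : SimpleGraph V} (hS : S.IsTree) (hle : S ≤ G) :
    ∑ e ∈ chords G T, w e ≤ ∑ e ∈ chords G S, w e :=
  not_lt.1 (hT.not_lt ⟨hS, hle⟩)

variable [IsOrderedCancelAddMonoid A] {w : Sym2 V → A}

theorem IsMinOmissionTree.le_of_excess_ne_zero (hmin : IsMinOmissionTree G w T) (hG : IsCactus G)
    {e f : Sym2 V} (he : e ∈ chords G T) (hef : excess G r e f ≠ 0) : w e ≤ w f := by
  classical
  obtain ⟨hT, hle⟩ := hmin.prop
  rw [hG.excess_eq_ite hT.connected hle he, ne_eq, ite_eq_right_iff, Classical.not_imp] at hef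
  have hf : f ∈ T.edgeSet := not_imp_comm.1 (unreached_deleteEdges_of_notMem hT.connected) hef.2
  have hle' : exchange T f e ≤ G := by
    rw [← edgeSet_subset_edgeSet, edgeSet_exchange (not_isDiag_of_mem_separated hef.1)]
    exact Set.insert_subset (mem_chords.1 he).1
      (Set.sdiff_subset.trans (edgeSet_subset_edgeSet.2 hle))
  have hsum := add_le_add_left (hmin.sum_le (isTree_exchange hT hef.1) hle') (w e)
  rwa [sum_chords_exchange w hle he hf hef.1, add_le_add_iff_left] at hsum

theorem IsMinOmissionTree.coe_chords_eq_omitted (hmin : IsMinOmissionTree G w T) (hG : IsCactus G)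
    (hw : Set.InjOn w G.edgeSet) (r : V) : (chords G T : Set (Sym2 V)) = omitted G r w := by
  obtain ⟨hT, hle⟩ := hmin.prop
  have hself : ∀ e ∈ chords G T, cut G r e e = 0 := fun e he =>
    cut_self_of_le hT.connected hle (mem_chords.1 he).2
  refine Set.Subset.antisymm (fun e he => ⟨(mem_chords.1 he).1, hself e he,
    fun f _ hef => hmin.le_of_excess_ne_zero hG he hef⟩) fun x ⟨hxG, hx, hxmin⟩ => ?_
  by_contra hxT
  replace hxT : x ∈ T.edgeSet := by_contra fun h => hxT (mem_chords.2 ⟨hxG, h⟩)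
  have hne : ∑ e ∈ chords G T, excess G r e x ≠ 0 := by
    have hsum := hG.unreached_deleteEdges_eq_cut_add_sum (r := r) hT.connected hle x
    rw [hx, zero_add] at hsum
    rw [← hsum, ne_eq, unreached_eq_zero_iff]
    exact not_connected_deleteEdges_of_mem hT hxT
  obtain ⟨e, he, hex⟩ := Finset.exists_ne_zero_of_sum_ne_zero hne
  have hcomm : excess G r x e = excess G r e x := by
    rw [excess, excess, cut_comm, hself e he, hx]
  have heq := hw (mem_chords.1 he).1 hxG
    ((hmin.le_of_excess_ne_zero hG he hex).antisymm (hxmin e (mem_chords.1 he).1 (hcomm ▸ hex)))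
  exact (mem_chords.1 he).2 (heq ▸ hxT)

theorem IsCactus.isMinOmissionTree_deleteEdges_omitted (hG : IsCactus G)
    (hw : Set.InjOn w G.edgeSet) (r : V) :
    IsMinOmissionTree G w (G.deleteEdges (omitted G r w)) := by
  obtain ⟨T, hT⟩ := exists_isMinOmissionTree hG.1 w
  have hle : T ≤ G := hT.prop.2
  convert hT
  rw [← edgeSet_inj, edgeSet_deleteEdges, ← hT.coe_chords_eq_omitted hG hw r]
  ext e
  simp only [Set.mem_sdiff, Finset.mem_coe, mem_chords, not_and, not_not]
  exact ⟨fun h => h.2 h.1, fun h => ⟨edgeSet_subset_edgeSet.2 hle h, fun _ => h⟩⟩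

/-- The penalties, made pairwise distinct by the tie break `idx`. -/
noncomputable def rank (G : SimpleGraph V) (γ τ : Sym2 V → ℝ) (r : V) (idx : Sym2 V → ℕ)
    (e : Sym2 V) : ℝ ×ₗ ℕ :=
  toLex (penalty G γ τ r e, idx e)

theorem IsCactus.isCableTrenchTree_deleteEdges_omitted (hG : IsCactus G) (γ τ : Sym2 V → ℝ)
    (r : V) {idx : Sym2 V → ℕ} (hidx : Set.InjOn idx G.edgeSet) :
    IsCableTrenchTree G γ τ r (G.deleteEdges (omitted G r (rank G γ τ r idx))) := by
  have hfst : ∀ s : Finset (Sym2 V),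
      (ofLex (∑ e ∈ s, rank G γ τ r idx e)).1 = ∑ e ∈ s, penalty G γ τ r e := fun s =>
    map_sum (OrderAddMonoidHom.fstₗ ℝ ℕ) _ s
  have hmin := hG.isMinOmissionTree_deleteEdges_omitted (w := rank G γ τ r idx)
    (fun e he f hf hef => hidx he hf (Prod.ext_iff.1 hef).2) r
  obtain ⟨hT, hle⟩ := hmin.prop
  refine ⟨hT, hle, fun S hS hSG => ?_⟩
  rw [hG.cost_eq_sum_penalty hT hle, hG.cost_eq_sum_penalty hS hSG, ← hfst, ← hfst]
  exact add_le_add_left (Prod.Lex.monotone_fst _ _ (hmin.sum_le hS hSG)) _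

end Optimum

section Programs

/-- A word register, word array, real register or real array of the machine. -/
inductive Cell where
  | reg (i : ℕ)
  | arr (a : ℕ)
  | rreg (i : ℕ)
  | rarr (a : ℕ)
  deriving DecidableEq

/-- The cells that an instruction may change. -/
def Instr.writes : Instr → List Cell
  | .skip => []
  | .const i _ | .add i _ _ | .sub i _ _ | .load i _ _ => [.reg i]
  | .store a _ _ => [.arr a]
  | .rzero i | .radd i _ _ | .rsub i _ _ | .rload i _ _ => [.rreg i]
  | .rstore a _ _ => [.rarr a]

/-- The cells that a program may change. -/
def Prog.writes : Prog → List Cell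
  | .instr a => a.writes
  | .seq P Q | .ite _ P Q => P.writes ++ Q.writes
  | .loop _ P => P.writes

/-- The states `s` and `s'` agree on all cells outside `W`. -/
structure Frame (W : List Cell) (s s' : State) : Prop where
  reg : ∀ i, (_ : Cell.reg i ∉ W := by decide) → s'.reg i = s.reg i
  arr : ∀ a, (_ : Cell.arr a ∉ W := by decide) → s'.arr a = s.arr a
  rreg : ∀ i, (_ : Cell.rreg i ∉ W := by decide) → s'.rreg i = s.rreg i
  rarr : ∀ a, (_ : Cell.rarr a ∉ W := by decide) → s'.rarr a = s.rarr a

theorem Frame.refl (W : List Cell) (s : State) : Frame W s s :=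
  ⟨fun _ _ => rfl, fun _ _ => rfl, fun _ _ => rfl, fun _ _ => rfl⟩

theorem Frame.trans {W : List Cell} {s₁ s₂ s₃ : State} (h : Frame W s₁ s₂) (h' : Frame W s₂ s₃) :
    Frame W s₁ s₃ where
  reg i hi := (h'.reg i hi).trans (h.reg i hi)
  arr a ha := (h'.arr a ha).trans (h.arr a ha)
  rreg i hi := (h'.rreg i hi).trans (h.rreg i hi)
  rarr a ha := (h'.rarr a ha).trans (h.rarr a ha)

theorem Frame.mono {W W' : List Cell} {s s' : State} (h : Frame W s s') (hW : W ⊆ W') :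
    Frame W' s s' where
  reg i hi := h.reg i (mt (@hW _) hi)
  arr a ha := h.arr a (mt (@hW _) ha)
  rreg i hi := h.rreg i (mt (@hW _) hi)
  rarr a ha := h.rarr a (mt (@hW _) ha)

theorem Instr.frame (a : Instr) (s : State) : Frame a.writes s (a.apply s) := by
  cases a <;> constructor <;> intro i hi <;>
    simp only [Instr.writes, List.mem_singleton, Cell.reg.injEq, Cell.arr.injEq, Cell.rreg.injEq,
      Cell.rarr.injEq] at hi <;>
    simp [Instr.apply, hi]

theorem Exec.frame {P : Prog} {s s' : State} {t : ℕ} (h : Exec P s t s') :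
    Frame P.writes s s' := by
  induction h with
  | instr a s => exact a.frame s
  | seq _ _ ih₁ ih₂ =>
    exact (ih₁.mono (List.subset_append_left ..)).trans (ih₂.mono (List.subset_append_right ..))
  | ite_true _ _ ih => exact ih.mono (List.subset_append_left ..)
  | ite_false _ _ ih => exact ih.mono (List.subset_append_right ..)
  | loop_true _ _ _ ih₁ ih₂ => exact ih₁.trans ih₂
  | loop_false _ => exact .refl ..

/-- Started in `s`, the program `P` halts after at most `B` steps in a state with the property
`Q`. -/
def Runs (P : Prog) (s : State) (B : ℕ) (Q : State → Prop) : Prop :=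
  ∃ t s', t ≤ B ∧ Exec P s t s' ∧ Q s'

infixr:60 " ;; " => Prog.seq

variable {P P' : Prog} {s : State} {B B' : ℕ} {Q Q' : State → Prop}

theorem Runs.instr {a : Instr} (h : Q (a.apply s)) : Runs (.instr a) s 1 Q :=
  ⟨1, _, le_rfl, .instr a s, h⟩

theorem Runs.of_le (h : Runs P s B Q) (hB : B ≤ B') : Runs P s B' Q := by
  obtain ⟨t, s', ht, he, hq⟩ := h
  exact ⟨t, s', ht.trans hB, he, hq⟩

theorem Runs.imp (h : Runs P s B Q) (hQ : ∀ s', Q s' → Frame P.writes s s' → Q' s') :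
    Runs P s B Q' := by
  obtain ⟨t, s', ht, he, hq⟩ := h
  exact ⟨t, s', ht, he, hQ _ hq he.frame⟩

theorem Runs.seq (h : Runs P s B Q)
    (h' : ∀ s', Q s' → Frame P.writes s s' → Runs P' s' B' Q') : Runs (P ;; P') s (B + B') Q' := by
  obtain ⟨t, s', ht, he, hq⟩ := h
  obtain ⟨t', s'', ht', he', hq'⟩ := h' s' hq he.frame
  exact ⟨t + t', s'', add_le_add ht ht', .seq he he', hq'⟩

theorem Runs.instr_seq {a : Instr} (h : Runs P (a.apply s) B Q) :
    Runs (.instr a ;; P) s (B + 1) Q :=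
  ((Runs.instr (Q := (· = a.apply s)) rfl).seq fun _ hs _ => hs ▸ h).of_le (Nat.add_comm 1 B).le

theorem Runs.ite {b : Test} (h₁ : b.Holds s → Runs P s B Q) (h₂ : ¬ b.Holds s → Runs P' s B Q) :
    Runs (.ite b P P') s (B + 1) Q := by
  by_cases hb : b.Holds s
  · obtain ⟨t, s', ht, he, hq⟩ := h₁ hb
    exact ⟨t + 1, s', Nat.succ_le_succ ht, .ite_true hb he, hq⟩
  · obtain ⟨t, s', ht, he, hq⟩ := h₂ hb
    exact ⟨t + 1, s', Nat.succ_le_succ ht, .ite_false hb he, hq⟩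

/-- `if b then P`. -/
def ifThen (b : Test) (P : Prog) : Prog :=
  .ite b P (.instr .skip)

theorem Runs.ifThen {b : Test} (hB : 1 ≤ B) (h₁ : b.Holds s → Runs P s B Q)
    (h₂ : ¬ b.Holds s → Q s) : Runs (ifThen b P) s (B + 1) Q :=
  Runs.ite h₁ fun hb => (Runs.instr (a := .skip) (h₂ hb)).of_le hB

/-- Execute `P` if the word registers `i` and `j` differ. -/
def ifNe (i j : ℕ) (P : Prog) : Prog :=
  .ite (.lt i j) P (ifThen (.lt j i) P)

theorem Runs.ifNe {i j : ℕ} (hB : 1 ≤ B) (h₁ : s.reg i ≠ s.reg j → Runs P s B Q)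
    (h₂ : s.reg i = s.reg j → Q s) : Runs (ifNe i j P) s (B + 2) Q :=
  Runs.ite (fun h => (h₁ h.ne).of_le B.le_succ) fun h =>
    Runs.ifThen hB (fun h' => h₁ h'.ne') fun h' => h₂ (le_antisymm (not_lt.1 h') (not_lt.1 h))

/-- Execute `P` if the pair of the real register `x` and the word register `i` is lexicographically
smaller than that of `y` and `j`. -/
def ifLexLt (x y i j : ℕ) (P : Prog) : Prog :=
  .ite (.rlt x y) P <| .ite (.rlt y x) (.instr .skip) <| ifThen (.lt i j) P

theorem Runs.ifLexLt {x y i j : ℕ} (hB : 1 ≤ B)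
    (h₁ : toLex (s.rreg x, s.reg i) < toLex (s.rreg y, s.reg j) → Runs P s B Q)
    (h₂ : ¬ toLex (s.rreg x, s.reg i) < toLex (s.rreg y, s.reg j) → Q s) :
    Runs (ifLexLt x y i j P) s (B + 3) Q := by
  simp only [Prod.Lex.toLex_lt_toLex] at h₁ h₂
  refine Runs.ite (fun hxy => (h₁ (.inl hxy)).of_le (by omega)) fun hxy => Runs.ite
    (fun hyx => (Runs.instr (a := .skip) (h₂ ?_)).of_le (by omega)) fun hyx => Runs.ifThen hB
    (fun hij => h₁ (.inr ⟨le_antisymm (not_lt.1 hyx) (not_lt.1 hxy), hij⟩)) fun hij => h₂ ?_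
  · exact not_or.2 ⟨hxy, fun h => hyx.ne' h.1⟩
  · exact not_or.2 ⟨hxy, fun h => hij h.2⟩

/-- Overwrite a word register. -/
def State.setReg (s : State) (i v : ℕ) : State := { s with reg := Function.update s.reg i v }

/-- `for i := 0 to reg b - 1 do P`, where the register `o` holds the number `1`. -/
def forLoop (i b o : ℕ) (P : Prog) : Prog :=
  .instr (.const i 0) ;; .loop (.lt i b) (P ;; .instr (.add i i o))

theorem Frame.setReg {W : List Cell} {s' : State} {i : ℕ} (h : Frame W s s') (hi : .reg i ∈ W)
    (v : ℕ) : Frame W s (s'.setReg i v) where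
  reg j hj := by
    have hji : j ≠ i := fun h => hj (h ▸ hi)
    simp [State.setReg, hji, h.reg j hj]
  arr a ha := h.arr a ha
  rreg j hj := h.rreg j hj
  rarr a ha := h.rarr a ha

theorem Runs.loop_succ {i b o k N : ℕ} (hP : ∀ j ∈ [i, b, o], .reg j ∉ P.writes)
    (hk : k < N) (hi : s.reg i = k) (hb : s.reg b = N) (ho : s.reg o = 1)
    (hbody : Runs P s B fun s' => Runs (.loop (.lt i b) (P ;; .instr (.add i i o)))
      (s'.setReg i (k + 1)) B' Q) :
    Runs (.loop (.lt i b) (P ;; .instr (.add i i o))) s (B + B' + 2) Q := by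
  obtain ⟨t, s', ht, he, t', s'', ht', he', hq⟩ := hbody
  refine ⟨t + 1 + t' + 1, s'', by omega, .loop_true ?_ (.seq he (.instr _ _)) ?_, hq⟩
  · simpa only [Test.Holds, hi, hb] using hk
  · have hadd : (Instr.add i i o).apply s' = s'.setReg i (k + 1) := by
      simp only [Instr.apply, State.setReg, he.frame.reg i (hP i (by simp)),
        he.frame.reg o (hP o (by simp)), hi, ho]
    rwa [hadd]

theorem Runs.forLoop {i b o N : ℕ} (Inv : ℕ → State → Prop) (hbo : i ∉ [b, o])
    (hP : ∀ j ∈ [i, b, o], .reg j ∉ P.writes) (hb : s.reg b = N) (ho : s.reg o = 1)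
    (h0 : Inv 0 (s.setReg i 0)) (hset : ∀ k s' v, Inv k s' → Inv k (s'.setReg i v))
    (hbody : ∀ k s', k < N → s'.reg i = k → Frame (forLoop i b o P).writes s s' → Inv k s' →
      Runs P s' B (Inv (k + 1))) :
    Runs (forLoop i b o P) s (N * (B + 2) + 2) (Inv N) := by
  set W := (CableTrench.forLoop i b o P).writes
  have hiW : .reg i ∈ W := by simp [W, CableTrench.forLoop, Prog.writes, Instr.writes]
  have hPW : P.writes ⊆ W := fun x hx => by simp [W, CableTrench.forLoop, Prog.writes, hx]
  have hreg : ∀ j ∈ [b, o], ∀ s', Frame W s s' → s'.reg j = s.reg j := fun j hj s' hf => by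
    have hji : j ≠ i := fun h => hbo (h ▸ hj)
    have hjP : .reg j ∉ P.writes := hP j (List.mem_cons_of_mem _ hj)
    exact hf.reg j (by simp [W, CableTrench.forLoop, Prog.writes, Instr.writes, hji, hjP])
  have hloop : ∀ d k s', k + d = N → s'.reg i = k → Frame W s s' → Inv k s' →
      Runs (.loop (.lt i b) (P ;; .instr (.add i i o))) s' (d * (B + 2) + 1) (Inv N) := by
    intro d
    induction d with
    | zero =>
      rintro k s' rfl hk hf hinv
      refine ⟨1, s', by omega, .loop_false ?_, hinv⟩
      simp [Test.Holds, hk, hreg b (by simp) s' hf, hb]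
    | succ d ih =>
      intro k s' hkN hk hf hinv
      refine (Runs.loop_succ (B := B) (B' := d * (B + 2) + 1) hP (by omega) hk
        ((hreg b (by simp) s' hf).trans hb) ((hreg o (by simp) s' hf).trans ho) ?_).of_le
        (by rw [Nat.succ_mul]; omega)
      exact (hbody k s' (by omega) hk hf hinv).imp fun s₁ hinv₁ hf₁ =>
        ih (k + 1) _ (by omega) (by simp [State.setReg])
          ((hf.trans (hf₁.mono hPW)).setReg hiW _) (hset _ _ _ hinv₁)
  exact Runs.instr_seq (hloop N 0 (s.setReg i 0) (Nat.zero_add N) (by simp [State.setReg])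
    ((Frame.refl W s).setReg hiW 0) h0)

end Programs

section Encoding

theorem forall_fin_lt_succ_iff {m k : ℕ} (hk : k < m) {p : Fin m → Prop} :
    (∀ j : Fin m, j < k + 1 → p j) ↔ (∀ j : Fin m, j < k → p j) ∧ p ⟨k, hk⟩ := by
  simp only [Nat.lt_succ_iff_lt_or_eq, or_imp, forall_and, ← Fin.ext_iff (b := ⟨k, hk⟩),
    forall_eq]

theorem exists_fin_lt_succ_iff {m k : ℕ} (hk : k < m) {p : Fin m → Prop} :
    (∃ j : Fin m, j < k + 1 ∧ p j) ↔ (∃ j : Fin m, j < k ∧ p j) ∨ p ⟨k, hk⟩ := by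
  simp only [Nat.lt_succ_iff_lt_or_eq, or_and_right, exists_or, ← Fin.ext_iff (b := ⟨k, hk⟩),
    exists_eq_left]

theorem sum_fin_lt_succ {m k : ℕ} (hk : k < m) {A : Type*} [AddCommMonoid A] (g : Fin m → A) :
    ∑ j : Fin m with j.val < k + 1, g j = ∑ j : Fin m with j.val < k, g j + g ⟨k, hk⟩ := by
  have hfilter : ({j | j.val < k + 1} : Finset (Fin m)) =
      insert ⟨k, hk⟩ ({j | j.val < k} : Finset (Fin m)) := by
    ext j
    simp [Fin.ext_iff, le_iff_eq_or_lt]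
  rw [hfilter, Finset.sum_insert (by simp), add_comm]

variable {n m : ℕ} {G : SimpleGraph (Fin n)} {L : EdgeListing G m} {γ τ : Sym2 (Fin n) → ℝ}
  {r : Fin n} {s s' : State}

theorem EdgeListing.exists_edge_eq (L : EdgeListing G m) {e : Sym2 (Fin n)} (he : e ∈ G.edgeSet) :
    ∃ k, L.edge k = e :=
  L.range_eq.ge he

theorem EdgeListing.edge_injective (L : EdgeListing G m) : Function.Injective L.edge :=
  L.injective

open Classical in
theorem EdgeListing.sum_edgeFinset (L : EdgeListing G m) {A : Type*} [AddCommMonoid A]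
    (g : Sym2 (Fin n) → A) : ∑ e ∈ G.edgeFinset, g e = ∑ k, g (L.edge k) :=
  (Finset.sum_bij (fun k _ => L.edge k) (fun k _ => SimpleGraph.mem_edgeFinset.2 (L.edge_mem k))
    (fun _ _ _ _ h => L.edge_injective h)
    (fun _ he => (L.exists_edge_eq (SimpleGraph.mem_edgeFinset.1 he)).imp fun _ h =>
      ⟨Finset.mem_univ _, h⟩)
    fun _ _ => rfl).symm

theorem EdgeListing.le_mul_self (L : EdgeListing G m) : m ≤ n * n := by
  have hinj : Function.Injective fun k => (L.src k, L.tgt k) := by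
    intro j k h
    rw [Prod.mk.injEq] at h
    exact L.injective (by simp only [h.1, h.2])
  simpa using Fintype.card_le_of_injective _ hinj

/-- The numbering of the edges by the listing; unlisted pairs get the junk value `0`. -/
noncomputable def EdgeListing.index (L : EdgeListing G m) : Sym2 (Fin n) → ℕ :=
  Function.extend L.edge Fin.val 0

theorem EdgeListing.index_edge (L : EdgeListing G m) (k : Fin m) : L.index (L.edge k) = k :=
  L.edge_injective.extend_apply _ _ _

theorem EdgeListing.injOn_index (L : EdgeListing G m) : Set.InjOn L.index G.edgeSet := by
  intro e he f hf h
  obtain ⟨j, rfl⟩ := L.exists_edge_eq he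
  obtain ⟨k, rfl⟩ := L.exists_edge_eq hf
  rw [L.index_edge, L.index_edge] at h
  rw [Fin.ext h]

theorem EdgeListing.mem_omitted_iff (L : EdgeListing G m) {A : Type*} [LinearOrder A]
    {w : Sym2 (Fin n) → A} {k : Fin m} : L.edge k ∈ omitted G r w ↔
      cut G r (L.edge k) (L.edge k) = 0 ∧
        ∀ j, excess G r (L.edge k) (L.edge j) ≠ 0 → ¬ w (L.edge j) < w (L.edge k) := by
  simp only [omitted, Set.mem_ofPred_eq, L.edge_mem, true_and, not_lt]
  refine and_congr_right fun _ => ⟨fun h j => h _ (L.edge_mem j), fun h x hx => ?_⟩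
  obtain ⟨j, rfl⟩ := L.exists_edge_eq hx
  exact h j

theorem outputGraph_eq_deleteEdges (L : EdgeListing G m) {X : Set (Sym2 (Fin n))}
    (h : ∀ k : Fin m, s.arr 3 k = 1 ↔ L.edge k ∉ X) : outputGraph L s = G.deleteEdges X := by
  rw [outputGraph, ← SimpleGraph.edgeSet_inj, SimpleGraph.edgeSet_fromEdgeSet,
    SimpleGraph.edgeSet_deleteEdges]
  ext x
  constructor
  · rintro ⟨⟨k, hk, rfl⟩, -⟩
    exact ⟨L.edge_mem k, (h k).1 hk⟩
  · rintro ⟨hx, hX⟩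
    obtain ⟨k, rfl⟩ := L.exists_edge_eq hx
    exact ⟨⟨k, (h k).2 hX, rfl⟩, G.not_isDiag_of_mem_edgeSet hx⟩

/- The allocation of memory. The cells up to `Reg.root`, `Arr.tgt` and `RArr.trench`, and
`Arr.output`, are those of `inputState` and `outputGraph`. -/

namespace Reg

@[simp] abbrev vertices : ℕ := 0
@[simp] abbrev edges : ℕ := 1
@[simp] abbrev root : ℕ := 3
@[simp] abbrev one : ℕ := 4
@[simp] abbrev zero : ℕ := 5
@[simp] abbrev edge : ℕ := 6
@[simp] abbrev other : ℕ := 7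
@[simp] abbrev deleted₁ : ℕ := 8
@[simp] abbrev deleted₂ : ℕ := 9
@[simp] abbrev round : ℕ := 10
@[simp] abbrev scan : ℕ := 11
@[simp] abbrev srcVertex : ℕ := 12
@[simp] abbrev tgtVertex : ℕ := 13
@[simp] abbrev srcMark : ℕ := 14
@[simp] abbrev tgtMark : ℕ := 15
@[simp] abbrev vertex : ℕ := 16
@[simp] abbrev mark : ℕ := 17
@[simp] abbrev count : ℕ := 18
@[simp] abbrev saved : ℕ := 19
@[simp] abbrev step : ℕ := 20
@[simp] abbrev keep : ℕ := 21

end Reg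

namespace Arr

@[simp] abbrev src : ℕ := 0
@[simp] abbrev tgt : ℕ := 1
@[simp] abbrev output : ℕ := 3
@[simp] abbrev marks : ℕ := 4

end Arr

namespace RReg

@[simp] abbrev total : ℕ := 0
@[simp] abbrev term : ℕ := 1

end RReg

namespace RArr

@[simp] abbrev cable : ℕ := 0
@[simp] abbrev trench : ℕ := 1
@[simp] abbrev penalty : ℕ := 2

end RArr

/-- The state `s` holds the graph `G` with root `r` and weights `γ` and `τ`, as in `inputState`. -/
structure Encodes (L : EdgeListing G m) (γ τ : Sym2 (Fin n) → ℝ) (r : Fin n) (s : State) :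
    Prop where
  vertices : s.reg Reg.vertices = n
  edges : s.reg Reg.edges = m
  root : s.reg Reg.root = r
  src : ∀ k : Fin m, s.arr Arr.src k = L.src k
  tgt : ∀ k : Fin m, s.arr Arr.tgt k = L.tgt k
  cable : ∀ k : Fin m, s.rarr RArr.cable k = γ (L.edge k)
  trench : ∀ k : Fin m, s.rarr RArr.trench k = τ (L.edge k)

theorem encodes_inputState {c : ℕ} (L : EdgeListing G m) (D : Decomposition G c)
    (γ τ : Sym2 (Fin n) → ℝ) (r : Fin n) : Encodes L γ τ r (inputState L D γ τ r) := by
  constructor <;> simp [inputState]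

/-- The state `s` holds the input and the constants `0` and `1`. -/
structure Env (L : EdgeListing G m) (γ τ : Sym2 (Fin n) → ℝ) (r : Fin n) (s : State) : Prop
    extends Encodes L γ τ r s where
  one : s.reg Reg.one = 1
  zero : s.reg Reg.zero = 0

/-- The cells described by `Env`. -/
def envCells : List Cell :=
  [.reg Reg.vertices, .reg Reg.edges, .reg Reg.root, .reg Reg.one, .reg Reg.zero,
    .arr Arr.src, .arr Arr.tgt, .rarr RArr.cable, .rarr RArr.trench]

theorem Env.frame (h : Env L γ τ r s) {W : List Cell} (hf : Frame W s s')
    (hW : ∀ x ∈ envCells, x ∉ W := by decide) : Env L γ τ r s' where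
  vertices := (hf.reg _ (hW _ (by decide))).trans h.vertices
  edges := (hf.reg _ (hW _ (by decide))).trans h.edges
  root := (hf.reg _ (hW _ (by decide))).trans h.root
  one := (hf.reg _ (hW _ (by decide))).trans h.one
  zero := (hf.reg _ (hW _ (by decide))).trans h.zero
  src k := (congrFun (hf.arr _ (hW _ (by decide))) _).trans (h.src k)
  tgt k := (congrFun (hf.arr _ (hW _ (by decide))) _).trans (h.tgt k)
  cable k := (congrFun (hf.rarr _ (hW _ (by decide))) _).trans (h.cable k)
  trench k := (congrFun (hf.rarr _ (hW _ (by decide))) _).trans (h.trench k)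

theorem Env.holds_zero_lt (h : Env L γ τ r s) (i : ℕ) :
    (Test.lt Reg.zero i).Holds s ↔ s.reg i ≠ 0 := by
  rw [Test.Holds, h.zero, Nat.pos_iff_ne_zero]

end Encoding

section Search

open SimpleGraph

variable {n m : ℕ} {G : SimpleGraph (Fin n)} {L : EdgeListing G m} {γ τ : Sym2 (Fin n) → ℝ}
  {r : Fin n} {s : State}

/-- The set of vertices that are marked as reached in the state `s`. -/
def State.marked (s : State) (n : ℕ) : Set (Fin n) :=
  {w | s.arr Arr.marks w ≠ 0}

theorem marked_store_marks {i j : ℕ} {w : Fin n} (hi : s.reg i = w) (hj : s.reg j ≠ 0) :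
    ((Instr.store Arr.marks i j).apply s).marked n = insert w (s.marked n) := by
  ext x
  simp only [State.marked, Instr.apply, Function.update_self, hi, Set.mem_insert_iff,
    Set.mem_ofPred_eq, Function.update_apply, Fin.val_inj]
  split_ifs with hx <;> simp [hx, hj]

/-- The set `M`, together with its neighbours in `H` along the edge `e`. -/
def relax {V : Type*} (H : SimpleGraph V) (e : Sym2 V) (M : Set V) : Set V :=
  M ∪ {w | ∃ u ∈ M, H.Adj u w ∧ s(u, w) = e}

theorem relax_of_notMem {V : Type*} {H : SimpleGraph V} {e : Sym2 V} (he : e ∉ H.edgeSet)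
    (M : Set V) : relax H e M = M :=
  Set.union_eq_left.2 fun _ ⟨_, _, hadj, huw⟩ => absurd (huw ▸ hadj) he

theorem relax_mk {V : Type*} {H : SimpleGraph V} {a b : V} (hab : H.Adj a b) (M : Set V)
    (hM : a ∈ M ∨ b ∈ M) : relax H s(a, b) M = insert b (insert a M) := by
  ext w
  simp only [relax, Set.mem_union, Set.mem_ofPred_eq, Set.mem_insert_iff, Sym2.eq_iff]
  constructor
  · rintro (hw | ⟨_, -, -, ⟨rfl, rfl⟩ | ⟨rfl, rfl⟩⟩)
    exacts [.inr (.inr hw), .inl rfl, .inr (.inl rfl)]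
  · rintro (rfl | rfl | hw)
    · exact hM.symm.imp_right fun ha => ⟨a, ha, hab, .inl ⟨rfl, rfl⟩⟩
    · exact hM.imp_right fun hb => ⟨b, hb, hab.symm, .inr ⟨rfl, rfl⟩⟩
    · exact .inl hw

theorem relax_mk_of_notMem {V : Type*} {H : SimpleGraph V} {a b : V} {M : Set V} (ha : a ∉ M)
    (hb : b ∉ M) : relax H s(a, b) M = M := by
  refine Set.union_eq_left.2 ?_
  rintro w ⟨u, hu, -, huw⟩
  rcases Sym2.eq_iff.1 huw with ⟨rfl, -⟩ | ⟨rfl, -⟩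
  exacts [absurd hu ha, absurd hu hb]

/-- Mark both ends of the edge `Reg.scan` if one of them is marked. -/
def spreadProg : Prog :=
  .instr (.load Reg.srcVertex Arr.src Reg.scan) ;;
  .instr (.load Reg.tgtVertex Arr.tgt Reg.scan) ;;
  .instr (.load Reg.srcMark Arr.marks Reg.srcVertex) ;;
  .instr (.load Reg.tgtMark Arr.marks Reg.tgtVertex) ;;
  .instr (.add Reg.mark Reg.srcMark Reg.tgtMark) ;;
  ifThen (.lt Reg.zero Reg.mark)
    (.instr (.store Arr.marks Reg.srcVertex Reg.one) ;;
      .instr (.store Arr.marks Reg.tgtVertex Reg.one))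

theorem runs_spreadProg (h : Env L γ τ r s) {k : Fin m} (hk : s.reg Reg.scan = k)
    {H : SimpleGraph (Fin n)} (hadj : H.Adj (L.src k) (L.tgt k)) :
    Runs spreadProg s 8 fun s' => s'.marked n = relax H (L.edge k) (s.marked n) := by
  refine Runs.instr_seq <| Runs.instr_seq <| Runs.instr_seq <| Runs.instr_seq <|
    Runs.instr_seq ?_
  set s₁ := Instr.apply _ _ with hs₁
  have hmarked : s₁.marked n = s.marked n := rfl
  have hsrc : s₁.reg Reg.srcVertex = L.src k := by simp [hs₁, Instr.apply, hk, h.src]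
  have htgt : s₁.reg Reg.tgtVertex = L.tgt k := by simp [hs₁, Instr.apply, hk, h.tgt]
  have hone : s₁.reg Reg.one ≠ 0 := by simp [hs₁, Instr.apply, h.one]
  have hholds : (Test.lt Reg.zero Reg.mark).Holds s₁ ↔
      L.src k ∈ s.marked n ∨ L.tgt k ∈ s.marked n := by
    have hmark : s₁.reg Reg.mark = s.arr Arr.marks (L.src k) + s.arr Arr.marks (L.tgt k) := by
      simp [hs₁, Instr.apply, hk, h.src, h.tgt]
    rw [Test.Holds, hmark, show s₁.reg Reg.zero = 0 from h.zero, add_pos_iff, Nat.pos_iff_ne_zero,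
      Nat.pos_iff_ne_zero]
    rfl
  refine Runs.ifThen (B := 2) one_le_two (fun hmark => ?_) fun hmark => ?_
  · refine Runs.instr_seq <| Runs.instr ?_
    rw [marked_store_marks (s := Instr.apply _ s₁) htgt hone, marked_store_marks hsrc hone, hmarked]
    exact (relax_mk hadj _ (hholds.1 hmark)).symm
  · obtain ⟨hs, ht⟩ := not_or.1 (mt hholds.2 hmark)
    exact (relax_mk_of_notMem hs ht).symm

/-- Mark both ends of the edge `Reg.scan` if one of them is marked, unless the edge is one of the
two deleted ones. -/
def relaxProg : Prog :=
  ifNe Reg.scan Reg.deleted₁ <| ifNe Reg.scan Reg.deleted₂ spreadProg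

theorem runs_relaxProg (h : Env L γ τ r s) {p q k : Fin m} (hp : s.reg Reg.deleted₁ = p)
    (hq : s.reg Reg.deleted₂ = q) (hk : s.reg Reg.scan = k) :
    Runs relaxProg s 12 fun s' => s'.marked n =
      relax (G.deleteEdges {L.edge p, L.edge q}) (L.edge k) (s.marked n) := by
  have hskip : k = p ∨ k = q →
      s.marked n = relax (G.deleteEdges {L.edge p, L.edge q}) (L.edge k) (s.marked n) :=
    fun hpq => (relax_of_notMem (fun he => by
      rw [edgeSet_deleteEdges] at he
      exact he.2 (hpq.imp (congrArg L.edge) (congrArg L.edge))) _).symm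
  simp only [Fin.ext_iff, ← hk, ← hp, ← hq] at hskip
  refine Runs.ifNe (by norm_num) (fun hkp => Runs.ifNe (by norm_num) (fun hkq => ?_)
    fun hkq => hskip (.inr hkq)) fun hkp => hskip (.inl hkp)
  refine runs_spreadProg h hk (deleteEdges_adj.2 ⟨L.edge_mem k, ?_⟩)
  rintro (he | he)
  · exact hkp (by rw [hk, hp, L.edge_injective he])
  · exact hkq (by rw [hk, hq, L.edge_injective he])

/-- Relax all the edges once. -/
def roundProg : Prog := forLoop Reg.scan Reg.edges Reg.one relaxProg

/-- `M` with its neighbours in `H` is contained in `M'`, and `M'` is reached from `M` in `H`. -/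
structure IsRound {V : Type*} (H : SimpleGraph V) (M M' : Set V) : Prop where
  subset : M ⊆ M'
  mem_of_adj : ∀ ⦃u w⦄, u ∈ M → H.Adj u w → w ∈ M'
  reachable : ∀ ⦃w⦄, w ∈ M' → ∃ u ∈ M, H.Reachable u w

theorem runs_roundProg (h : Env L γ τ r s) {p q : Fin m} (hp : s.reg Reg.deleted₁ = p)
    (hq : s.reg Reg.deleted₂ = q) :
    Runs roundProg s (m * 14 + 2) fun s' =>
      IsRound (G.deleteEdges {L.edge p, L.edge q}) (s.marked n) (s'.marked n) := by
  set H := G.deleteEdges {L.edge p, L.edge q} with hH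
  refine (Runs.forLoop (B := 12) (fun k s' => s.marked n ⊆ s'.marked n ∧
      (∀ w ∈ s'.marked n, ∃ u ∈ s.marked n, H.Reachable u w) ∧
      ∀ j : Fin m, j < k → ∀ u ∈ s.marked n, ∀ w, H.Adj u w → s(u, w) = L.edge j →
        w ∈ s'.marked n)
    (by decide) (by decide) h.edges h.one
    ⟨subset_rfl, fun w hw => ⟨w, hw, .rfl⟩, fun _ hj => absurd hj (Nat.not_lt_zero _)⟩
    (fun _ _ _ h => h) ?_).imp fun s' ⟨hsub, hreach, hadj⟩ _ => ⟨hsub, fun u w hu huw => ?_, hreach⟩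
  · rintro k s₁ hk hk' hf ⟨hsub, hreach, hadj⟩
    refine (runs_relaxProg (k := ⟨k, hk⟩) (h.frame hf) ((hf.reg _).trans hp)
      ((hf.reg _).trans hq) hk').imp fun s₂ hs₂ _ => ?_
    rw [hs₂, ← hH]
    refine ⟨hsub.trans Set.subset_union_left, ?_, (forall_fin_lt_succ_iff hk).2
      ⟨fun j hj u hu w huw he => .inl (hadj j hj u hu w huw he),
        fun u hu w huw he => .inr ⟨u, hsub hu, huw, he⟩⟩⟩
    rintro w (hw | ⟨v, hv, hvw, -⟩)
    · exact hreach w hw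
    · exact (hreach v hv).imp fun u ⟨hu, huv⟩ => ⟨hu, huv.trans hvw.reachable⟩
  · obtain ⟨j, hj⟩ := L.exists_edge_eq (e := s(u, w)) (deleteEdges_adj.1 huw).1
    exact hadj j j.2 u hu w huw hj.symm

/-- Unmark all the vertices but the root. -/
def resetProg : Prog :=
  forLoop Reg.vertex Reg.vertices Reg.one (.instr (.store Arr.marks Reg.vertex Reg.zero)) ;;
  .instr (.store Arr.marks Reg.root Reg.one)

theorem runs_resetProg (h : Env L γ τ r s) :
    Runs resetProg s (n * 3 + 3) fun s' => s'.marked n = {r} := by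
  refine Runs.seq (B := n * 3 + 2) (B' := 1) (Runs.forLoop (B := 1)
    (fun k s' => ∀ w < k, s'.arr Arr.marks w = 0) (by decide) (by decide) h.vertices h.one
    (by simp) (fun _ _ _ h => h) fun k s₁ hk hk' hf hi => Runs.instr fun w hw => ?_)
    fun s₁ hs₁ hf => Runs.instr ?_
  · simp only [Instr.apply, Function.update_self, hk', hf.reg Reg.zero, h.zero]
    rcases Nat.lt_succ_iff_lt_or_eq.1 hw with hw | rfl
    · rw [Function.update_of_ne hw.ne, hi w hw]
    · exact Function.update_self ..
  · have h₁ := h.frame hf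
    rw [marked_store_marks h₁.root (h₁.one ▸ one_ne_zero)]
    have hempty : s₁.marked n = ∅ :=
      Set.eq_empty_of_forall_notMem fun w hw => hw (hs₁ w w.2)
    rw [hempty, insert_empty_eq]

/-- Mark the vertices that are reachable from the root without the two deleted edges. -/
def searchProg : Prog :=
  resetProg ;; forLoop Reg.round Reg.vertices Reg.one roundProg

theorem runs_searchProg (h : Env L γ τ r s) {p q : Fin m} (hp : s.reg Reg.deleted₁ = p)
    (hq : s.reg Reg.deleted₂ = q) :
    Runs searchProg s (n * 3 + 3 + (n * (m * 14 + 4) + 2)) fun s' =>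
      s'.marked n = {w | (G.deleteEdges {L.edge p, L.edge q}).Reachable r w} := by
  set H := G.deleteEdges {L.edge p, L.edge q}
  refine (runs_resetProg h).seq fun s₁ hs₁ hf₁ => ?_
  have h₁ := h.frame hf₁
  refine (Runs.forLoop (B := m * 14 + 2) (fun k s' =>
      s'.marked n ⊆ {w | H.Reachable r w} ∧
      ∀ (w : Fin n) (x : H.Walk w r), x.length ≤ k → w ∈ s'.marked n)
    (by decide) (by decide) h₁.vertices h₁.one ?_ (fun _ _ _ h => h) ?_).imp ?_
  · change s₁.marked n ⊆ _ ∧ ∀ w (x : H.Walk w r), _ → w ∈ s₁.marked n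
    rw [hs₁]
    exact ⟨Set.singleton_subset_iff.2 (Reachable.refl r),
      fun w x hx => Walk.eq_of_length_eq_zero (Nat.le_zero.1 hx)⟩
  · rintro k s₂ - - hf₂ ⟨hsub, hwalk⟩
    refine (runs_roundProg (h₁.frame hf₂) (((hf₂.reg _).trans (hf₁.reg _)).trans hp)
      (((hf₂.reg _).trans (hf₁.reg _)).trans hq)).imp fun s₃ hround _ => ⟨fun w hw => ?_, ?_⟩
    · obtain ⟨u, hu, huw⟩ := hround.reachable hw
      exact (hsub hu).trans huw
    · rintro w (_ | ⟨hadj, x⟩) hx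
      · exact hround.subset (hwalk _ .nil (Nat.zero_le k))
      · exact hround.mem_of_adj (hwalk _ x (Nat.le_of_succ_le_succ hx)) hadj.symm
  · rintro s₂ ⟨hsub, hwalk⟩ -
    refine hsub.antisymm fun w hw => ?_
    obtain ⟨x, hx⟩ := hw.symm.exists_isPath
    exact hwalk w x (hx.length_lt.le.trans (Fintype.card_fin n).le)

/-- Count the vertices that are not reachable from the root without the two deleted edges. -/
def countProg : Prog :=
  searchProg ;; .instr (.const Reg.count 0) ;;
  forLoop Reg.vertex Reg.vertices Reg.one
    (.instr (.load Reg.mark Arr.marks Reg.vertex) ;;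
      .ite (.lt Reg.zero Reg.mark) (.instr .skip) (.instr (.add Reg.count Reg.count Reg.one)))

/-- A bound for the running time of `countProg`. -/
def countTime {R : Type*} [CommSemiring R] (n m : R) : R :=
  n * 3 + 3 + (n * (m * 14 + 4) + 2) + (n * 5 + 3)

theorem runs_countProg (h : Env L γ τ r s) {p q : Fin m} (hp : s.reg Reg.deleted₁ = p)
    (hq : s.reg Reg.deleted₂ = q) :
    Runs countProg s (countTime n m) fun s' =>
      s'.reg Reg.count = cut G r (L.edge p) (L.edge q) := by
  refine (runs_searchProg h hp hq).seq fun s₁ hs₁ hf₁ => Runs.instr_seq ?_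
  set s₂ := Instr.apply (.const Reg.count 0) s₁
  have h₂ : Env L γ τ r s₂ := (h.frame hf₁).frame (Instr.frame ..)
  refine (Runs.forLoop (B := 3) (fun k s' => s'.reg Reg.count =
      ∑ w ∈ Finset.range k, if s₂.arr Arr.marks w = 0 then 1 else 0)
    (by decide) (by decide) h₂.vertices h₂.one (by simp [State.setReg, s₂, Instr.apply])
    (fun k s' v h => by simpa [State.setReg] using h) ?_).imp fun s₃ hs₃ _ => ?_
  · intro k s₃ _ hk' hf hi
    have h₃ := h₂.frame hf
    have h₄ := h₃.frame (Instr.frame (.load Reg.mark Arr.marks Reg.vertex) s₃)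
    rw [Finset.sum_range_succ, ← hi, ← hf.arr Arr.marks, ← hk']
    refine Runs.instr_seq <| Runs.ite (B := 1) (fun hb => Runs.instr ?_) fun hb => Runs.instr ?_
    all_goals rw [h₄.holds_zero_lt] at hb
    · rw [if_neg (by simpa [Instr.apply] using hb)]
      simp [Instr.apply]
    · rw [if_pos (by simpa [Instr.apply] using hb)]
      simp [Instr.apply, h₃.one]
  · have hunreached : {w | ¬ (G.deleteEdges {L.edge p, L.edge q}).Reachable r w} =
        {w : Fin n | s₂.arr Arr.marks w = 0} := by
      ext w
      exact not_iff_comm.1 (Set.ext_iff.1 hs₁ w)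
    rw [hs₃, cut, unreached, hunreached, Set.ncard_eq_toFinset_card', Finset.sum_range,
      Set.toFinset_ofPred, Finset.card_filter]

end Search

section Algorithm

variable {n m : ℕ} {G : SimpleGraph (Fin n)} {L : EdgeListing G m} {γ τ : Sym2 (Fin n) → ℝ}
  {r : Fin n} {s : State} {e f : Fin m}

/-- Count the vertices that are not reachable from the root without the edges whose numbers are in
the word registers `i` and `j`. -/
def cutProg (i j : ℕ) : Prog :=
  .instr (.add Reg.deleted₁ i Reg.zero) ;; .instr (.add Reg.deleted₂ j Reg.zero) ;; countProg

theorem runs_cutProg (h : Env L γ τ r s) {i j : ℕ} (hj : j ≠ Reg.deleted₁) (he : s.reg i = e)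
    (hf : s.reg j = f) : Runs (cutProg i j) s (countTime n m + 1 + 1) fun s' =>
      s'.reg Reg.count = cut G r (L.edge e) (L.edge f) :=
  Runs.instr_seq <| Runs.instr_seq <| runs_countProg
    ((h.frame (Instr.frame _ s) (by simp [envCells, Instr.writes])).frame (Instr.frame _ _)
      (by simp [envCells, Instr.writes]))
    (by simp [Instr.apply, he, h.zero])
    (by simp [Instr.apply, Function.update_of_ne hj, hf, h.zero])

/-- Compute the excess of the edges `Reg.edge` and `Reg.other`. -/
def excessProg : Prog :=
  cutProg Reg.other Reg.other ;; .instr (.add Reg.saved Reg.count Reg.zero) ;;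
  cutProg Reg.edge Reg.other ;; .instr (.sub Reg.count Reg.count Reg.saved)

/-- A bound for the running time of `excessProg`. -/
def excessTime {R : Type*} [CommSemiring R] (n m : R) : R :=
  countTime n m + 1 + 1 + (countTime n m + 1 + 1 + 1 + 1)

theorem runs_excessProg (h : Env L γ τ r s) (he : s.reg Reg.edge = e) (hf : s.reg Reg.other = f) :
    Runs excessProg s (excessTime n m) fun s' =>
      s'.reg Reg.count = excess G r (L.edge e) (L.edge f) := by
  refine (runs_cutProg h (by decide) hf hf).seq fun s₁ hs₁ hf₁ => Runs.instr_seq ?_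
  have h₁ := h.frame hf₁
  have h₁' := h₁.frame (Instr.frame (.add Reg.saved Reg.count Reg.zero) s₁)
  refine (runs_cutProg (i := Reg.edge) (j := Reg.other) h₁' (by decide) ((hf₁.reg _).trans he)
    ((hf₁.reg _).trans hf)).seq fun s₂ hs₂ hf₂ => Runs.instr ?_
  have hsaved : s₂.reg Reg.saved = cut G r (L.edge f) (L.edge f) := by
    rw [hf₂.reg _, ← hs₁]
    simp [Instr.apply, h₁.zero]
  simp [Instr.apply, hs₂, hsaved, excess]

theorem unreached_le_card {V : Type*} [Fintype V] (H : SimpleGraph V) (r : V) :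
    unreached H r ≤ Fintype.card V :=
  (Set.ncard_le_card _).trans_eq Nat.card_eq_fintype_card

theorem excess_le_card {V : Type*} [Fintype V] (H : SimpleGraph V) (r : V) (e f : Sym2 V) :
    excess H r e f ≤ Fintype.card V :=
  (Nat.sub_le ..).trans (unreached_le_card ..)

/-- Add to `RReg.total` the contribution of the edge `Reg.other` to the penalty of `Reg.edge`; the
multiplication is a repeated addition. -/
def addExcessProg : Prog :=
  excessProg ;; .instr (.rload RReg.term RArr.cable Reg.other) ;;
  forLoop Reg.step Reg.count Reg.one (.instr (.radd RReg.total RReg.total RReg.term))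

theorem runs_addExcessProg (h : Env L γ τ r s) (he : s.reg Reg.edge = e)
    (hf : s.reg Reg.other = f) :
    Runs addExcessProg s (excessTime n m + (n * 3 + 2 + 1)) fun s' => s'.rreg RReg.total =
      s.rreg RReg.total + γ (L.edge f) * excess G r (L.edge e) (L.edge f) := by
  refine (runs_excessProg h he hf).seq fun s₁ hs₁ hf₁ => Runs.instr_seq ?_
  have h₁ := h.frame hf₁
  set s₂ := Instr.apply _ s₁
  have hterm : s₂.rreg RReg.term = γ (L.edge f) := by
    simp [s₂, Instr.apply, hf₁.reg Reg.other, hf, h₁.cable]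
  have htotal : s₂.rreg RReg.total = s.rreg RReg.total := hf₁.rreg RReg.total
  refine (Runs.forLoop (B := 1)
    (fun k s' => s'.rreg RReg.total = s.rreg RReg.total + γ (L.edge f) * k)
    (by decide) (by decide) (s := s₂) hs₁ (h₁.frame (Instr.frame _ s₁)).one
    (by simp [State.setReg, htotal]) (fun _ _ _ h => h)
    fun k s₃ _ _ hf₃ hi => Runs.instr ?_).of_le ?_
  · simp only [Instr.apply, Function.update_self, hi, hf₃.rreg RReg.term, hterm]
    push_cast
    ring
  · have hle := excess_le_card G r (L.edge e) (L.edge f)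
    rw [Fintype.card_fin] at hle
    omega

/-- Compute and store the penalty of the edge `Reg.edge`. -/
def penaltyProg : Prog :=
  .instr (.rzero RReg.total) ;; forLoop Reg.other Reg.edges Reg.one addExcessProg ;;
  .instr (.rload RReg.term RArr.trench Reg.edge) ;;
  .instr (.rsub RReg.total RReg.total RReg.term) ;;
  .instr (.rstore RArr.penalty Reg.edge RReg.total)

/-- A bound for the running time of `penaltyProg`. -/
def penaltyTime {R : Type*} [CommSemiring R] (n m : R) : R :=
  m * (excessTime n m + (n * 3 + 2 + 1) + 2) + 2 + (1 + 1 + 1) + 1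

theorem runs_penaltyProg (h : Env L γ τ r s) (he : s.reg Reg.edge = e) :
    Runs penaltyProg s (penaltyTime n m) fun s' => s'.rarr RArr.penalty =
      Function.update (s.rarr RArr.penalty) e (penalty G γ τ r (L.edge e)) := by
  refine Runs.instr_seq ?_
  set s₁ := Instr.apply (.rzero RReg.total) s
  have h₁ : Env L γ τ r s₁ := h.frame (Instr.frame ..)
  refine (Runs.forLoop (B := excessTime n m + (n * 3 + 2 + 1)) (fun k s' => s'.rreg RReg.total =
      ∑ j : Fin m with j.val < k, γ (L.edge j) * excess G r (L.edge e) (L.edge j))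
    (by decide) (by decide) h₁.edges h₁.one (by simp [State.setReg, s₁, Instr.apply])
    (fun _ _ _ h => h) ?_).seq fun s₂ hs₂ hf₂ => ?_
  · intro k s₂ hk hk' hf hi
    refine (runs_addExcessProg (f := ⟨k, hk⟩) (h₁.frame hf) ((hf.reg _).trans he) hk').imp
      fun s₃ hs₃ _ => ?_
    rw [hs₃, hi, sum_fin_lt_succ hk]
  · refine Runs.instr_seq <| Runs.instr_seq <| Runs.instr ?_
    have hedge : s₂.reg Reg.edge = e := (hf₂.reg _).trans he
    have hpenalty : s₂.rarr RArr.penalty = s.rarr RArr.penalty := hf₂.rarr _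
    simp [Instr.apply, hedge, hpenalty, hs₂, (h₁.frame hf₂).trench, penalty, L.sum_edgeFinset]

/-- Set `Reg.keep` to `1` if the edge `Reg.other` rules out the omission of the edge `Reg.edge`,
whose penalty is in `RReg.total`. -/
def compareProg : Prog :=
  excessProg ;; ifThen (.lt Reg.zero Reg.count)
    (.instr (.rload RReg.term RArr.penalty Reg.other) ;;
      ifLexLt RReg.term RReg.total Reg.other Reg.edge (.instr (.const Reg.keep 1)))

theorem runs_compareProg (h : Env L γ τ r s) (he : s.reg Reg.edge = e) (hf : s.reg Reg.other = f)
    (hpe : s.rreg RReg.total = penalty G γ τ r (L.edge e))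
    (hpf : s.rarr RArr.penalty f = penalty G γ τ r (L.edge f)) :
    Runs compareProg s (excessTime n m + 6) fun s' => s'.reg Reg.keep = 1 ↔
      s.reg Reg.keep = 1 ∨ excess G r (L.edge e) (L.edge f) ≠ 0 ∧
        rank G γ τ r L.index (L.edge f) < rank G γ τ r L.index (L.edge e) := by
  refine (runs_excessProg h he hf).seq fun s₁ hs₁ hf₁ => Runs.ifThen (B := 5) (by norm_num)
    (fun hx => Runs.instr_seq ?_) fun hx => ?_
  all_goals
    rw [(h.frame hf₁).holds_zero_lt, hs₁] at hx
    rw [← hf₁.reg Reg.keep]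
  · set s₂ := Instr.apply _ s₁ with hs₂
    have hrankf : toLex (s₂.rreg RReg.term, s₂.reg Reg.other) =
        rank G γ τ r L.index (L.edge f) := by
      simp [rank, L.index_edge, hs₂, Instr.apply, hf₁.reg Reg.other, hf, hf₁.rarr RArr.penalty, hpf]
    have hranke : toLex (s₂.rreg RReg.total, s₂.reg Reg.edge) =
        rank G γ τ r L.index (L.edge e) := by
      simp [rank, L.index_edge, hs₂, Instr.apply, hf₁.reg Reg.edge, he, hf₁.rreg RReg.total, hpe]
    rw [← hrankf, ← hranke]
    refine Runs.ifLexLt le_rfl (fun hlt => Runs.instr ?_) fun hlt => ?_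
    · exact iff_of_true (by simp [Instr.apply]) (.inr ⟨hx, hlt⟩)
    · exact (or_iff_left fun h => hlt h.2).symm
  · exact (or_iff_left fun h => hx h.1).symm

/-- Set `Reg.keep` to `1` if the edge `Reg.edge` is a bridge, and to `0` otherwise. -/
def bridgeProg : Prog :=
  .instr (.const Reg.keep 0) ;; cutProg Reg.edge Reg.edge ;;
  ifThen (.lt Reg.zero Reg.count) (.instr (.const Reg.keep 1))

theorem runs_bridgeProg (h : Env L γ τ r s) (he : s.reg Reg.edge = e) :
    Runs bridgeProg s (countTime n m + 1 + 1 + (1 + 1) + 1) fun s' =>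
      s'.reg Reg.keep = 1 ↔ cut G r (L.edge e) (L.edge e) ≠ 0 := by
  have h₀ := h.frame (Instr.frame (.const Reg.keep 0) s)
  refine Runs.instr_seq <| (runs_cutProg (i := Reg.edge) (j := Reg.edge) h₀ (by decide) he he).seq
    fun s₁ hs₁ hf₁ => Runs.ifThen le_rfl (fun hb => Runs.instr ?_) fun hb => ?_
  all_goals rw [(h₀.frame hf₁).holds_zero_lt, hs₁] at hb
  · exact iff_of_true (by simp [Instr.apply]) hb
  · exact iff_of_false (by simp [hf₁.reg Reg.keep, Instr.apply]) hb

/-- Decide whether the edge `Reg.edge` belongs to the tree. -/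
def decideProg : Prog :=
  bridgeProg ;; .instr (.rload RReg.total RArr.penalty Reg.edge) ;;
  forLoop Reg.other Reg.edges Reg.one compareProg ;;
  .instr (.store Arr.output Reg.edge Reg.keep)

/-- A bound for the running time of `decideProg`. -/
def decideTime {R : Type*} [CommSemiring R] (n m : R) : R :=
  countTime n m + 1 + 1 + (1 + 1) + 1 + (m * (excessTime n m + 6 + 2) + 2 + 1 + 1)

theorem runs_decideProg (h : Env L γ τ r s) (he : s.reg Reg.edge = e)
    (hpenalty : ∀ k : Fin m, s.rarr RArr.penalty k = penalty G γ τ r (L.edge k)) :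
    Runs decideProg s (decideTime n m) fun s' =>
      (s'.arr Arr.output e = 1 ↔ L.edge e ∉ omitted G r (rank G γ τ r L.index)) ∧
      ∀ k : Fin m, k ≠ e → s'.arr Arr.output k = s.arr Arr.output k := by
  refine (runs_bridgeProg h he).seq fun s₁ hs₁ hf₁ => Runs.instr_seq ?_
  set s₂ := Instr.apply _ s₁ with hs₂
  have h₂ : Env L γ τ r s₂ := (h.frame hf₁).frame (Instr.frame ..)
  have hpenalty₂ : s₂.rarr RArr.penalty = s.rarr RArr.penalty := hf₁.rarr _
  have hedge₂ : s₂.reg Reg.edge = e := (hf₁.reg _).trans he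
  have htotal : s₂.rreg RReg.total = penalty G γ τ r (L.edge e) := by
    simp [hs₂, Instr.apply, hf₁.reg Reg.edge, he, hf₁.rarr RArr.penalty, hpenalty]
  refine (Runs.forLoop (B := excessTime n m + 6) (fun k s' => s'.reg Reg.keep = 1 ↔
      cut G r (L.edge e) (L.edge e) ≠ 0 ∨ ∃ j : Fin m, j < k ∧
        excess G r (L.edge e) (L.edge j) ≠ 0 ∧
          rank G γ τ r L.index (L.edge j) < rank G γ τ r L.index (L.edge e))
    (by decide) (by decide) h₂.edges h₂.one (by simpa [State.setReg, s₂, Instr.apply] using hs₁)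
    (fun _ _ _ h => by simpa [State.setReg] using h) ?_).seq fun s₃ hs₃ hf₃ => Runs.instr ?_
  · intro k s₃ hk hk' hf hi
    refine (runs_compareProg (f := ⟨k, hk⟩) (h₂.frame hf) ((hf.reg _).trans hedge₂) hk'
      ((hf.rreg _).trans htotal) ?_).imp fun s₄ hs₄ _ => ?_
    · rw [hf.rarr RArr.penalty, hpenalty₂, hpenalty]
    · rw [hs₄, hi, or_assoc, exists_fin_lt_succ_iff hk]
  · have hedge₃ : s₃.reg Reg.edge = e := (hf₃.reg _).trans hedge₂
    have houtput : s₃.arr Arr.output = s.arr Arr.output := (hf₃.arr _).trans (hf₁.arr _)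
    simp only [Instr.apply, Function.update_self, hedge₃, houtput]
    refine ⟨?_, fun k hk => Function.update_of_ne (Fin.val_injective.ne hk) ..⟩
    rw [hs₃, L.mem_omitted_iff]
    simp [or_iff_not_imp_left]

/-- Compute the penalties of all the edges, then decide which of them belong to the tree. -/
def cactusProg : Prog :=
  .instr (.const Reg.one 1) ;; .instr (.const Reg.zero 0) ;;
  forLoop Reg.edge Reg.edges Reg.one penaltyProg ;; forLoop Reg.edge Reg.edges Reg.one decideProg

/-- A bound for the running time of `cactusProg`. -/
def cactusTime {R : Type*} [CommSemiring R] (n m : R) : R :=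
  m * (penaltyTime n m + 2) + 2 + (m * (decideTime n m + 2) + 2) + 1 + 1

theorem runs_penalties (h : Env L γ τ r s) :
    Runs (forLoop Reg.edge Reg.edges Reg.one penaltyProg) s (m * (penaltyTime n m + 2) + 2)
      fun s' => ∀ k : Fin m, s'.rarr RArr.penalty k = penalty G γ τ r (L.edge k) := by
  refine (Runs.forLoop (B := penaltyTime n m)
    (fun k s' => ∀ j : Fin m, j < k → s'.rarr RArr.penalty j = penalty G γ τ r (L.edge j))
    (by decide) (by decide) h.edges h.one (by simp) (fun _ _ _ h => h) ?_).imp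
    fun s' hs' _ j => hs' j j.2
  intro k s₁ hk hk' hf hi
  refine (runs_penaltyProg (e := ⟨k, hk⟩) (h.frame hf) hk').imp fun s₂ hs₂ _ => ?_
  rw [forall_fin_lt_succ_iff hk, hs₂]
  exact ⟨fun j hj => (Function.update_of_ne hj.ne ..).trans (hi j hj), Function.update_self ..⟩

theorem runs_decisions (h : Env L γ τ r s)
    (hpenalty : ∀ k : Fin m, s.rarr RArr.penalty k = penalty G γ τ r (L.edge k)) :
    Runs (forLoop Reg.edge Reg.edges Reg.one decideProg) s (m * (decideTime n m + 2) + 2)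
      fun s' => ∀ k : Fin m,
        s'.arr Arr.output k = 1 ↔ L.edge k ∉ omitted G r (rank G γ τ r L.index) := by
  refine (Runs.forLoop (B := decideTime n m) (fun k s' => ∀ j : Fin m, j < k →
      (s'.arr Arr.output j = 1 ↔ L.edge j ∉ omitted G r (rank G γ τ r L.index)))
    (by decide) (by decide) h.edges h.one (by simp) (fun _ _ _ h => h) ?_).imp
    fun s' hs' _ j => hs' j j.2
  intro k s₁ hk hk' hf hi
  refine (runs_decideProg (e := ⟨k, hk⟩) (h.frame hf) hk' fun j => ?_).imp
    fun s₂ ⟨hs₂, hne⟩ _ => ?_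
  · rw [hf.rarr RArr.penalty, hpenalty]
  · rw [forall_fin_lt_succ_iff hk]
    refine ⟨fun j hj => ?_, hs₂⟩
    rw [hne j (Fin.ne_of_val_ne hj.ne), hi j hj]

theorem runs_cactusProg (h : Encodes L γ τ r s) :
    Runs cactusProg s (cactusTime n m) fun s' => ∀ k : Fin m,
      s'.arr Arr.output k = 1 ↔ L.edge k ∉ omitted G r (rank G γ τ r L.index) := by
  refine Runs.instr_seq <| Runs.instr_seq ?_
  set s₁ := Instr.apply _ (Instr.apply _ s)
  have h₁ : Env L γ τ r s₁ :=
    { vertices := h.vertices, edges := h.edges, root := h.root, src := h.src, tgt := h.tgt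
      cable := h.cable, trench := h.trench, one := rfl, zero := rfl }
  exact (runs_penalties h₁).seq fun s₂ hs₂ hf₂ => runs_decisions (h₁.frame hf₂) hs₂

theorem cactusTime_mono_right (n : ℕ) : Monotone (cactusTime n) := by
  intro m m' h
  unfold cactusTime penaltyTime decideTime excessTime countTime
  gcongr

theorem eval_cactusTime {R : Type*} [CommSemiring R] (x : R) (p q : Polynomial R) :
    (cactusTime p q).eval x = cactusTime (p.eval x) (q.eval x) := by
  simp [cactusTime, penaltyTime, decideTime, excessTime, countTime]

end Algorithm

end CableTrench

open CableTrench in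
theorem mainTheorem1_general :
    ∃ (P : Prog) (p : Polynomial ℕ), ∀ (n m : ℕ) (G : SimpleGraph (Fin n)), IsCactus G →
      ∀ (L : EdgeListing G m) (γ τ : Sym2 (Fin n) → ℝ) (r : Fin n) (s₀ : State),
        Encodes L γ τ r s₀ →
          ∃ (t : ℕ) (s : State), t ≤ p.eval n ∧ Exec P s₀ t s ∧
            IsCableTrenchTree G γ τ r (outputGraph L s) := by
  refine ⟨cactusProg, cactusTime .X (.X * .X), fun n m G hG L γ τ r s₀ h => ?_⟩
  obtain ⟨t, s, ht, hexec, houtput⟩ := runs_cactusProg h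
  refine ⟨t, s, ?_, hexec, ?_⟩
  · rw [eval_cactusTime, Polynomial.eval_mul, Polynomial.eval_X]
    exact ht.trans (cactusTime_mono_right n L.le_mul_self)
  · rw [outputGraph_eq_deleteEdges L houtput]
    exact hG.isCableTrenchTree_deleteEdges_omitted γ τ r L.injOn_index

theorem mainTheorem1 :
    ∃ (P : CableTrench.Prog) (p : Polynomial ℕ),
      ∀ (n m c : ℕ) (G : SimpleGraph (Fin n)), CableTrench.IsCactus G →
        ∀ (L : CableTrench.EdgeListing G m) (D : CableTrench.Decomposition G c)
          (γ τ : Sym2 (Fin n) → ℝ) (r : Fin n),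
          ∃ (t : ℕ) (s : CableTrench.State),
            t ≤ p.eval n ∧
            CableTrench.Exec P (CableTrench.inputState L D γ τ r) t s ∧
            CableTrench.IsCableTrenchTree G γ τ r (CableTrench.outputGraph L s) := by
  obtain ⟨P, p, h⟩ := mainTheorem1_general
  exact ⟨P, p, fun n m _ G hG L D γ τ r =>
    h n m G hG L γ τ r _ (CableTrench.encodes_inputState L D γ τ r)⟩
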